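/- Let $f_0(z)=\exp\bigl(z/(1-z)\bigr)$ and $f_1(z)=e^{x}E_1(x)$ with $x=1/(1-z)$, where $E_1(x)=\int_x^\infty e^{-t}t^{-1}\,dt$. Let $a_n=[z^n]f_0(z)$ and $b_n=[z^n]f_1(z)$ be their Maclaurin coefficients, and let $\rho_n=a_nb_n$. There is exactly one real sequence $(d_k)_{k\ge 0}$ such that $$\rho_n\sim-\frac{1}{2n^{3/2}}\sum_{k\ge 0}d_k\,n^{-k}\qquad(n\to\infty)$$ in the sense of Poincaré, that is, $-2n^{3/2}\rho_n=\sum_{k=0}^{M-1}d_kn^{-k}+O(n^{-M})$ as $n\to\infty$ for every fixed $M\ge 0$. This sequence satisfies $d_0=1$ and, for all $k\ge 1$, $$8k\,d_k=\sum_{j=0}^{k-1}\alpha_{j,k}\,d_j,$$ where, with $m=k-j$, $\tau=j+\tfrac12$ and $(\tau)_n=\tau(\tau+1)\cdots(\tau+n-1)$, $$\begin{aligned}\alpha_{j,k}={}&(-1+3\cdot 2^{m-1}-2\cdot 3^m)\frac{(\tau)_{m-1}}{(m-1)!}+(7-17\cdot 2^m+17\cdot 3^m)\frac{(\tau)_m}{m!}\\&+(-13+38\cdot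 2^m-33\cdot 3^m)\frac{(\tau)_{m+1}}{(m+1)!}+6(1-4\cdot 2^m+3\cdot 3^m)\frac{(\tau)_{m+2}}{(m+2)!}.\end{aligned}$$ Consequently the rescaled sequence $r_k=2^{6k}d_k$ satisfies $r_0=1$ and, for all $k\ge 1$, $$k\,r_k=\sum_{j=0}^{k-1}\beta_{j,k}\,r_j,\qquad \beta_{j,k}=8^{2k-2j-1}\alpha_{j,k}.$$ -/

import Mathlib

open Filter Asymptotics

noncomputable section

/-- The exponential integral `E₁(x) = ∫_x^∞ e^{-t}/t dt`, for real `x > 0`. -/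
def expIntegralE1 (x : ℝ) : ℝ := ∫ t in Set.Ioi x, Real.exp (-t) / t

/-- `f₀(z) = exp(z/(1-z))`, on the real part of the unit disk. -/
def f0 (z : ℝ) : ℝ := Real.exp (z / (1 - z))

/-- `f₁(z) = exp(x) E₁(x)` with `x = 1/(1-z)`, on the real part of the unit disk. -/
def f1 (z : ℝ) : ℝ := Real.exp (1 / (1 - z)) * expIntegralE1 (1 / (1 - z))

/-- The `n`-th Maclaurin coefficient `[zⁿ] f(z)`. -/
def maclaurinCoeff (f : ℝ → ℝ) (n : ℕ) : ℝ := iteratedDeriv n f 0 / (n.factorial : ℝ)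

/-- The coefficients `ρ_n = a_n b_n` of the Hadamard product of `f₀` and `f₁`. -/
def rho (n : ℕ) : ℝ := maclaurinCoeff f0 n * maclaurinCoeff f1 n

/-- `u_n ∼ ∑_{k ≥ 0} c_k n^{-k}` as `n → ∞`, in the sense of Poincaré. -/
def HasAsymptoticSeries (u : ℕ → ℝ) (c : ℕ → ℝ) : Prop :=
  ∀ m : ℕ, (fun n : ℕ => u n - ∑ k ∈ Finset.range m, c k / (n : ℝ) ^ k)
    =O[atTop] (fun n : ℕ => 1 / (n : ℝ) ^ m)

/-- `ρ_n ∼ -(1/(2 n^{3/2})) ∑_{k ≥ 0} d_k n^{-k}`. -/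
def IsRhoExpansion (d : ℕ → ℝ) : Prop :=
  HasAsymptoticSeries (fun n : ℕ => -(2 * (n : ℝ) ^ (3 / 2 : ℝ)) * rho n) d

/-- `(τ)_n / n!`, where `(τ)_n = τ (τ+1) ⋯ (τ+n-1)` is the ascending factorial. -/
def pochRatio (τ : ℝ) (n : ℕ) : ℝ := (ascPochhammer ℝ n).eval τ / (n.factorial : ℝ)

/-- The coefficient `α_{j,k}` for `m = k - j ≥ 1`, `τ = j + 1/2`. -/
def alpha (j k : ℕ) : ℝ :=
  let m : ℕ := k - j
  let τ : ℝ := (j : ℝ) + 1 / 2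
  (-1 + 3 * 2 ^ (m - 1) - 2 * 3 ^ m) * pochRatio τ (m - 1)
    + (7 - 17 * 2 ^ m + 17 * 3 ^ m) * pochRatio τ m
    + (-13 + 38 * 2 ^ m - 33 * 3 ^ m) * pochRatio τ (m + 1)
    + 6 * (1 - 4 * 2 ^ m + 3 * 3 ^ m) * pochRatio τ (m + 2)

/-- The coefficient `β_{j,k} = 8^{2k-2j-1} α_{j,k}` for `j < k`. -/
def beta (j k : ℕ) : ℝ := 8 ^ (2 * k - 2 * j - 1) * alpha j k

/-- The rescaled sequence `r_k = 2^{6k} d_k`. -/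
def rescaled (d : ℕ → ℝ) (k : ℕ) : ℝ := 2 ^ (6 * k) * d k

end

open scoped Topology

noncomputable section

/-! Both functions satisfy `(1-z)² y' = y - c(1-z)`, with `c = 0` for `f0` and `c = 1` for `f1`.
Hence `a_n` and `b_n` obey one second-order recurrence for `n ≥ 1`, in which `c` enters only through
the initial step. Two consequences carry the proof.

Existence of the expansion. The Casoratian gives `ρ_n (r_n - s_n) = -1/(n(n+1))`, where `r_n =
a_{n+1}/a_n` and `s_n = b_{n+1}/b_n` (`casoratian`, `scaledRho_eq`). Both ratios solve the same
Riccati equation, which has approximate solutions to any order, given by one polynomial evaluated at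
`t = n^{-1/2}` and at `t = -n^{-1/2}` (`exists_riccatiDefect_eq`). Since `r_n ≥ 1`, errors contract
forwards; since `0 < s_n < 1`, they contract backwards. So each ratio follows its own branch. The
bounds on `s_n` come from a Laplace-type integral for `b_n`. The difference of the branches is odd
in `t`, so only integer powers of `1/n` remain after multiplication by `√n`.

Recurrence for the coefficients. Products of solutions of a second-order recurrence satisfy a
third-order one (`rho_recurrence`). Inserting the series, re-expanding the shifts `n - i` by the
binomial series and reading off the coefficient of `n^{-(k+2)}` cancels `d_{k+2}` and `d_{k+1}` and
leaves `8k d_k` against the earlier terms (`HasAsymptoticSeries.recurrence`). -/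

/-! ### Algebra and uniqueness of truncated asymptotic sums. -/

theorem tendsto_one_div_natCast : Tendsto (fun n : ℕ => 1 / (n : ℝ)) atTop (𝓝 0) :=
  tendsto_one_div_atTop_nhds_zero_nat

theorem isBigO_one_div_pow_of_le {k m : ℕ} (h : k ≤ m) :
    (fun n : ℕ => 1 / (n : ℝ) ^ m) =O[atTop] (fun n : ℕ => 1 / (n : ℝ) ^ k) := by
  refine IsBigO.of_bound 1 ?_
  filter_upwards [eventually_ge_atTop 1] with n hn
  have h1 : (1 : ℝ) ≤ n := by exact_mod_cast hn
  rw [Real.norm_of_nonneg (by positivity), Real.norm_of_nonneg (by positivity), one_mul]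
  exact one_div_le_one_div_of_le (by positivity) (pow_le_pow_right₀ h1 h)

/-- `u n = ∑_{k < m} c k / n ^ k + O(n ^ {-m})` for one fixed order `m`. -/
def HasAsymptoticSum (u c : ℕ → ℝ) (m : ℕ) : Prop :=
  (fun n : ℕ => u n - ∑ k ∈ Finset.range m, c k / (n : ℝ) ^ k)
    =O[atTop] (fun n : ℕ => 1 / (n : ℝ) ^ m)

theorem HasAsymptoticSum.mono {u c : ℕ → ℝ} {k m : ℕ} (h : HasAsymptoticSum u c m) (hk : k ≤ m) :
    HasAsymptoticSum u c k := by
  have h1 : (fun n : ℕ => ∑ i ∈ Finset.Ico k m, c i / (n : ℝ) ^ i)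
      =O[atTop] (fun n : ℕ => 1 / (n : ℝ) ^ k) := by
    apply IsBigO.fun_sum
    intro i hi
    have := (isBigO_one_div_pow_of_le (Finset.mem_Ico.1 hi).1).const_mul_left (c i)
    simpa only [mul_one_div] using this
  refine ((IsBigO.trans h (isBigO_one_div_pow_of_le hk)).add h1).congr_left fun n => ?_
  rw [← Finset.sum_range_add_sum_Ico _ hk]
  ring

theorem HasAsymptoticSum.add {u v c d : ℕ → ℝ} {m : ℕ} (hu : HasAsymptoticSum u c m)
    (hv : HasAsymptoticSum v d m) :
    HasAsymptoticSum (fun n => u n + v n) (fun k => c k + d k) m := by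
  refine (IsBigO.add hu hv).congr_left fun n => ?_
  simp only [add_div, Finset.sum_add_distrib]
  ring

theorem HasAsymptoticSum.const_mul {u c : ℕ → ℝ} {m : ℕ} (a : ℝ) (hu : HasAsymptoticSum u c m) :
    HasAsymptoticSum (fun n => a * u n) (fun k => a * c k) m := by
  refine (IsBigO.const_mul_left hu a).congr_left fun n => ?_
  simp only [mul_sub, Finset.mul_sum, mul_div_assoc]

theorem HasAsymptoticSum.congr {u v c : ℕ → ℝ} {m : ℕ} (hu : HasAsymptoticSum u c m)
    (h : u =ᶠ[atTop] v) : HasAsymptoticSum v c m := by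
  refine IsBigO.congr' hu ?_ EventuallyEq.rfl
  filter_upwards [h] with n hn
  rw [hn]

/-- The coefficient sequence of `x ↦ x * ∑ c k x ^ k`. -/
def shiftCoeff (c : ℕ → ℝ) : ℕ → ℝ
  | 0 => 0
  | k + 1 => c k

theorem HasAsymptoticSum.div_natCast {u c : ℕ → ℝ} {m : ℕ} (hu : HasAsymptoticSum u c m) :
    HasAsymptoticSum (fun n => u n / n) (shiftCoeff c) (m + 1) := by
  have h := IsBigO.mul hu (isBigO_refl (fun n : ℕ => 1 / (n : ℝ)) atTop)
  refine h.congr (fun n => ?_) (fun n => ?_)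
  · rw [Finset.sum_range_succ', sub_mul, Finset.sum_mul]
    simp only [shiftCoeff, zero_div, add_zero]
    congr 1
    · ring
    · refine Finset.sum_congr rfl fun k _ => ?_
      rw [div_mul_div_comm, mul_one, pow_succ]
  · rw [div_mul_div_comm, mul_one, pow_succ]

theorem HasAsymptoticSum.eq_zero {c : ℕ → ℝ} {m : ℕ} (h : HasAsymptoticSum (fun _ => 0) c m) :
    ∀ k < m, c k = 0 := by
  intro k
  induction k using Nat.strong_induction_on with
  | _ k ih =>
    intro hk
    have h1 := h.mono (Nat.succ_le_of_lt hk)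
    have h2 : (fun n : ℕ => -(c k / (n : ℝ) ^ k)) =O[atTop] fun n : ℕ => 1 / (n : ℝ) ^ (k + 1) := by
      refine IsBigO.congr_left h1 fun n => ?_
      rw [Finset.sum_range_succ, Finset.sum_eq_zero, zero_add, zero_sub]
      intro i hi
      rw [ih i (Finset.mem_range.1 hi) ((Finset.mem_range.1 hi).trans hk), zero_div]
    have h3 := h2.mul (isBigO_refl (fun n : ℕ => (n : ℝ) ^ k) atTop)
    have h4 : (fun _ : ℕ => -c k) =O[atTop] fun n : ℕ => 1 / (n : ℝ) := by
      refine h3.congr' ?_ ?_ <;> filter_upwards [eventually_ge_atTop 1] with n hn <;>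
        have : (n : ℝ) ≠ 0 := by positivity
      · field_simp
      · rw [pow_succ]
        field_simp
    have h5 := h4.trans_tendsto tendsto_one_div_natCast
    simpa using tendsto_nhds_unique tendsto_const_nhds h5

theorem HasAsymptoticSum.coeff_unique {u c d : ℕ → ℝ} {m : ℕ} (hc : HasAsymptoticSum u c m)
    (hd : HasAsymptoticSum u d m) : ∀ k < m, c k = d k := by
  intro k hk
  have h := (hc.add (hd.const_mul (-1))).congr (v := fun _ => 0)
    (Eventually.of_forall fun n => by simp)
  have := h.eq_zero k hk
  linarith

theorem HasAsymptoticSeries.unique {u c d : ℕ → ℝ} (hc : HasAsymptoticSeries u c)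
    (hd : HasAsymptoticSeries u d) : c = d :=
  funext fun k => HasAsymptoticSum.coeff_unique (hc (k + 1)) (hd (k + 1)) k k.lt_succ_self

/-- Expansions of different orders agree on their common coefficients by uniqueness, so a diagonal
choice gives a single series. -/
theorem exists_hasAsymptoticSeries {u : ℕ → ℝ} (h : ∀ m, ∃ c, HasAsymptoticSum u c m) :
    ∃ c, HasAsymptoticSeries u c := by
  choose c hc using h
  refine ⟨fun k => c (k + 1) k, fun m => ?_⟩
  refine IsBigO.congr_left (hc m) fun n => ?_
  congr 1
  refine Finset.sum_congr rfl fun k hk => ?_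
  have hk := Finset.mem_range.1 hk
  rw [((hc m).mono (Nat.succ_le_of_lt hk)).coeff_unique (hc (k + 1)) k k.lt_succ_self]

theorem HasAsymptoticSeries.tendsto {u c : ℕ → ℝ} (hc : HasAsymptoticSeries u c) :
    Tendsto u atTop (𝓝 (c 0)) := by
  have h := (hc 1).trans_tendsto (by simpa using tendsto_one_div_natCast)
  simpa using h.add_const (c 0)

/-! ### Taylor and binomial expansions; the shift `n ↦ n - i`. -/

theorem HasFPowerSeriesAt.isBigO_sub_sum {f : ℝ → ℝ} {p : FormalMultilinearSeries ℝ ℝ ℝ}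
    (hf : HasFPowerSeriesAt f p 0) (m : ℕ) :
    (fun x => f x - ∑ k ∈ Finset.range m, p.coeff k * x ^ k) =O[𝓝 0] fun x => x ^ m := by
  have h := hf.isBigO_sub_partialSum_pow m
  simp only [zero_add, FormalMultilinearSeries.partialSum,
    FormalMultilinearSeries.apply_eq_pow_smul_coeff, smul_eq_mul, ← norm_pow] at h
  simpa only [mul_comm] using isBigO_norm_right.1 h

theorem AnalyticAt.exists_hasAsymptoticSum {f : ℝ → ℝ} (hf : AnalyticAt ℝ f 0) (m : ℕ) :
    ∃ c, HasAsymptoticSum (fun n => f (1 / n)) c m := by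
  obtain ⟨p, hp⟩ := hf
  refine ⟨p.coeff, ?_⟩
  refine ((hp.isBigO_sub_sum m).comp_tendsto tendsto_one_div_natCast).congr (fun n => ?_)
    fun n => by simp
  simp [div_eq_mul_inv]

theorem isBigO_one_div_one_sub_rpow (τ : ℝ) (m : ℕ) :
    (fun x : ℝ => 1 / (1 - x) ^ τ - ∑ s ∈ Finset.range m, pochRatio τ s * x ^ s)
      =O[𝓝 0] fun x => x ^ m := by
  have h := (Real.one_div_one_sub_rpow_hasFPowerSeriesOnBall_zero
    τ).hasFPowerSeriesAt.isBigO_sub_sum m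
  refine h.congr_left fun x => ?_
  congr 1
  refine Finset.sum_congr rfl fun s _ => ?_
  congr 1
  rw [FormalMultilinearSeries.coeff_ofScalars, ← Ring.multichoose_eq, pochRatio,
    eq_div_iff (by positivity)]
  have := Ring.factorial_nsmul_multichoose_eq_ascPochhammer τ s
  rw [nsmul_eq_mul, Polynomial.ascPochhammer_smeval_eq_eval] at this
  rw [← this, mul_comm]

/-- Coefficients of the expansion of `(1 - i/n)^{-1/2} u (n - i)` when `u n ∼ ∑ d k n ^ {-k}`. -/
def translateCoeff (d : ℕ → ℝ) (i k : ℕ) : ℝ :=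
  ∑ j ∈ Finset.range (k + 1), d j * (pochRatio ((j : ℝ) + 1 / 2) (k - j) * (i : ℝ) ^ (k - j))

theorem isBigO_one_div_natCast_sub_pow (i m : ℕ) :
    (fun n : ℕ => 1 / ((n - i : ℕ) : ℝ) ^ m) =O[atTop] fun n : ℕ => 1 / (n : ℝ) ^ m := by
  refine IsBigO.of_bound (2 ^ m) ?_
  filter_upwards [eventually_ge_atTop (2 * i + 1)] with n hn
  have h1 : (n : ℝ) ≤ 2 * ((n - i : ℕ) : ℝ) := by exact_mod_cast (by omega : n ≤ 2 * (n - i))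
  have h2 : (0 : ℝ) < n := by exact_mod_cast (by omega : 0 < n)
  rw [Real.norm_of_nonneg (by positivity), Real.norm_of_nonneg (by positivity), mul_one_div,
    div_le_div_iff₀ (pow_pos (by linarith) m) (by positivity), one_mul, ← mul_pow]
  gcongr

theorem tendsto_natCast_div_natCast (i : ℕ) :
    Tendsto (fun n : ℕ => (i : ℝ) / n) atTop (𝓝 0) :=
  tendsto_const_div_atTop_nhds_zero_nat _

/-- Since `n - i = n(1 - i/n)`, the term `d_j (n-i)^{-j}` times the square-root factor is `d_j
n^{-j} (1 - i/n)^{-(j+1/2)}`. Its binomial series is the source of the parameter `τ = j + 1/2`. -/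
theorem HasAsymptoticSum.translate {u d : ℕ → ℝ} {m : ℕ} (hu : HasAsymptoticSum u d m) (i : ℕ) :
    HasAsymptoticSum (fun n => u (n - i) / (1 - (i : ℝ) / n) ^ (1 / 2 : ℝ))
      (translateCoeff d i) m := by
  have hE : (fun n : ℕ => (u (n - i) - ∑ k ∈ Finset.range m, d k / ((n - i : ℕ) : ℝ) ^ k)
      * (1 / (1 - (i : ℝ) / n) ^ (1 / 2 : ℝ))) =O[atTop] fun n : ℕ => 1 / (n : ℝ) ^ m := by
    have h1 := (hu.comp_tendsto (tendsto_sub_atTop_nat i)).trans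
      (isBigO_one_div_natCast_sub_pow i m)
    have h2 := (isBigO_one_div_one_sub_rpow (1 / 2) 0).comp_tendsto (tendsto_natCast_div_natCast i)
    simpa [Function.comp_def] using h1.mul h2
  have hT : ∀ j ∈ Finset.range m, (fun n : ℕ => d j / (n : ℝ) ^ j *
      (1 / (1 - (i : ℝ) / n) ^ ((j : ℝ) + 1 / 2) - ∑ s ∈ Finset.range (m - j),
        pochRatio ((j : ℝ) + 1 / 2) s * ((i : ℝ) / n) ^ s))
      =O[atTop] fun n : ℕ => 1 / (n : ℝ) ^ m := by
    intro j hj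
    have h1 := (isBigO_one_div_one_sub_rpow ((j : ℝ) + 1 / 2) (m - j)).comp_tendsto
      (tendsto_natCast_div_natCast i)
    have h2 : (fun n : ℕ => d j / (n : ℝ) ^ j) =O[atTop] fun n : ℕ => 1 / (n : ℝ) ^ j := by
      simpa only [mul_one_div] using
        (isBigO_refl (fun n : ℕ => 1 / (n : ℝ) ^ j) atTop).const_mul_left (d j)
    have h3 : (fun n : ℕ => ((i : ℝ) / n) ^ (m - j)) =O[atTop]
        fun n : ℕ => 1 / (n : ℝ) ^ (m - j) := by
      simpa only [mul_one_div, div_pow] using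
        (isBigO_refl (fun n : ℕ => 1 / (n : ℝ) ^ (m - j)) atTop).const_mul_left ((i : ℝ) ^ (m - j))
    refine (h2.mul (h1.trans h3)).congr_right fun n => ?_
    rw [div_mul_div_comm, one_mul, ← pow_add, Nat.add_sub_cancel' (Finset.mem_range.1 hj).le]
  -- Two errors add up: the truncation of `u` itself, and that of each binomial series, cut at order
  -- `m - j` because `n^{-j}` is already present.
  refine (hE.add (IsBigO.fun_sum hT)).congr' ?_ EventuallyEq.rfl
  filter_upwards [eventually_ge_atTop (i + 1)] with n hn
  have hn0 : (0 : ℝ) < n := by exact_mod_cast (by omega : 0 < n)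
  have hy : 0 < 1 - (i : ℝ) / n := by
    rw [sub_pos, div_lt_one hn0]
    exact_mod_cast hn
  have hsub : ((n - i : ℕ) : ℝ) = n * (1 - (i : ℝ) / n) := by
    rw [Nat.cast_sub (by omega)]
    field_simp
  have e1 : ∑ k ∈ Finset.range m, translateCoeff d i k / (n : ℝ) ^ k
      = ∑ j ∈ Finset.range m, d j / (n : ℝ) ^ j *
        ∑ s ∈ Finset.range (m - j), pochRatio ((j : ℝ) + 1 / 2) s * ((i : ℝ) / n) ^ s := by
    simp only [Finset.mul_sum]
    rw [← Finset.sum_range_diag_flip m fun j s =>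
      d j / (n : ℝ) ^ j * (pochRatio ((j : ℝ) + 1 / 2) s * ((i : ℝ) / n) ^ s)]
    refine Finset.sum_congr rfl fun k _ => ?_
    rw [translateCoeff, Finset.sum_div]
    refine Finset.sum_congr rfl fun j hj => ?_
    have hk : (n : ℝ) ^ k = (n : ℝ) ^ j * (n : ℝ) ^ (k - j) := by
      rw [← pow_add, Nat.add_sub_cancel' (Nat.lt_succ_iff.1 (Finset.mem_range.1 hj))]
    rw [hk, div_pow]
    field_simp
  have e2 : ∀ j : ℕ, d j / ((n - i : ℕ) : ℝ) ^ j * (1 / (1 - (i : ℝ) / n) ^ (1 / 2 : ℝ))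
      = d j / (n : ℝ) ^ j * (1 / (1 - (i : ℝ) / n) ^ ((j : ℝ) + 1 / 2)) := by
    intro j
    rw [hsub, Real.rpow_add hy, Real.rpow_natCast, mul_pow, div_mul_div_comm, div_mul_div_comm,
      mul_assoc]
  rw [e1, sub_mul, Finset.sum_mul]
  simp only [mul_sub, Finset.sum_sub_distrib, e2]
  ring

/-! ### From a recurrence of the sequence to one of its coefficients. -/

@[simp] theorem pochRatio_zero (τ : ℝ) : pochRatio τ 0 = 1 := by simp [pochRatio]

theorem pochRatio_one (τ : ℝ) : pochRatio τ 1 = τ := by simp [pochRatio]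

theorem pochRatio_two (τ : ℝ) : pochRatio τ 2 = τ * (τ + 1) / 2 := by
  simp [pochRatio, ascPochhammer_succ_eval]

theorem translateCoeff_add (d : ℕ → ℝ) (i k l : ℕ) :
    translateCoeff d i (k + l) = ∑ j ∈ Finset.range k, d j *
        (pochRatio ((j : ℝ) + 1 / 2) (k - j + l) * (i : ℝ) ^ (k - j + l)) +
      ∑ j ∈ Finset.range (l + 1), d (k + j) *
        (pochRatio (((k + j : ℕ) : ℝ) + 1 / 2) (l - j) * (i : ℝ) ^ (l - j)) := by
  rw [translateCoeff, add_assoc, Finset.sum_range_add]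
  congr 1
  · refine Finset.sum_congr rfl fun j hj => ?_
    rw [Nat.sub_add_comm (Finset.mem_range.1 hj).le]
  · refine Finset.sum_congr rfl fun j hj => ?_
    rw [Nat.add_sub_add_left]

/-- If `u` has an asymptotic series and `n ^ (-1/2) * u n` satisfies the third-order linear
recurrence of `n * ρ_n`, then the coefficients of the series satisfy the recurrence with
coefficients `alpha`. -/
theorem HasAsymptoticSeries.recurrence {u d : ℕ → ℝ} (hu : HasAsymptoticSeries u d)
    (hrec : ∀ᶠ n : ℕ in atTop,
      (2 - 5 / (n : ℝ) + 3 / (n : ℝ) ^ 2) * u n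
      - (6 - 13 / (n : ℝ) + 7 / (n : ℝ) ^ 2 - 1 / (n : ℝ) ^ 3)
        * (u (n - 1) / (1 - ((1 : ℕ) : ℝ) / n) ^ (1 / 2 : ℝ))
      + (6 - 19 / (n : ℝ) + 17 / (n : ℝ) ^ 2 - 3 / (n : ℝ) ^ 3)
        * (u (n - 2) / (1 - ((2 : ℕ) : ℝ) / n) ^ (1 / 2 : ℝ))
      - (2 - 11 / (n : ℝ) + 17 / (n : ℝ) ^ 2 - 6 / (n : ℝ) ^ 3)
        * (u (n - 3) / (1 - ((3 : ℕ) : ℝ) / n) ^ (1 / 2 : ℝ)) = 0)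
    (k : ℕ) (hk : 1 ≤ k) :
    8 * (k : ℝ) * d k = ∑ j ∈ Finset.range k, alpha j k * d j := by
  obtain ⟨q, rfl⟩ : ∃ q, k = q + 1 := ⟨k - 1, by omega⟩
  -- Order `q + 4` is needed because the informative coefficient has index `k + 2 = q + 3`.
  have hpoly : ∀ {v c : ℕ → ℝ} (a₀ a₁ a₂ a₃ : ℝ), HasAsymptoticSum v c (q + 4) →
      HasAsymptoticSum (fun n => a₀ * v n + (a₁ * (v n / n) + (a₂ * (v n / n / n)
        + a₃ * (v n / n / n / n))))
        (fun j => a₀ * c j + (a₁ * shiftCoeff c j + (a₂ * shiftCoeff (shiftCoeff c) j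
          + a₃ * shiftCoeff (shiftCoeff (shiftCoeff c)) j))) (q + 4) := by
    intro v c a₀ a₁ a₂ a₃ h
    have s1 := h.div_natCast
    have s2 := s1.div_natCast
    have s3 := s2.div_natCast
    exact (h.const_mul a₀).add (((s1.mono (by omega)).const_mul a₁).add
      (((s2.mono (by omega)).const_mul a₂).add ((s3.mono (by omega)).const_mul a₃)))
  have h0 := hpoly 2 (-5) 3 0 (hu (q + 4))
  have h1 := hpoly (-6) 13 (-7) 1 ((show HasAsymptoticSum u d (q + 4) from hu _).translate 1)
  have h2 := hpoly 6 (-19) 17 (-3) ((show HasAsymptoticSum u d (q + 4) from hu _).translate 2)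
  have h3 := hpoly (-2) 11 (-17) 6 ((show HasAsymptoticSum u d (q + 4) from hu _).translate 3)
  have key := (((h0.add h1).add (h2.add h3)).congr (v := fun _ => 0) (by
    filter_upwards [hrec] with n hn
    refine Eq.trans ?_ hn
    ring)).eq_zero (q + 3) (by omega)
  -- `A i l` collects what the `d_j` with `j < k` contribute to the coefficient of index `k + l`
  -- after the shift by `i`; `B i` is the same for index `k - 1`.
  set A : ℕ → ℕ → ℝ := fun i l => ∑ j ∈ Finset.range (q + 1), d j *
    (pochRatio ((j : ℝ) + 1 / 2) (q + 1 - j + l) * (i : ℝ) ^ (q + 1 - j + l))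
  set B : ℕ → ℝ := fun i => ∑ j ∈ Finset.range (q + 1), d j *
    (pochRatio ((j : ℝ) + 1 / 2) (q - j) * (i : ℝ) ^ (q - j))
  have t : ∀ i l, translateCoeff d i (q + 1 + l) = A i l +
      ∑ j ∈ Finset.range (l + 1), d (q + 1 + j) *
        (pochRatio (((q + 1 + j : ℕ) : ℝ) + 1 / 2) (l - j) * (i : ℝ) ^ (l - j)) :=
    fun i l => translateCoeff_add d i (q + 1) l
  have t3 : ∀ i, translateCoeff d i q = B i := fun i => rfl
  simp only [shiftCoeff] at key
  rw [show q + 3 = q + 1 + 2 from rfl, show q + 2 = q + 1 + 1 from rfl, t 1 2, t 2 2, t 3 2, t 1 1,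
    t 2 1, t 3 1, show translateCoeff d 1 (q + 1) = _ from t 1 0,
    show translateCoeff d 2 (q + 1) = _ from t 2 0, show translateCoeff d 3 (q + 1) = _ from t 3 0,
    t3, t3, t3] at key
  simp only [Finset.sum_range_succ _ 2, Finset.sum_range_succ _ 1, Finset.sum_range_succ _ 0,
    Finset.sum_range_zero, Nat.sub_zero, Nat.sub_self, Nat.reduceSub, zero_add,
    pochRatio_zero, pochRatio_one, pochRatio_two, pow_zero, pow_one, add_zero] at key
  have hα : ∑ j ∈ Finset.range (q + 1), alpha j (q + 1) * d j =
      6 * A 1 2 - 6 * A 2 2 + 2 * A 3 2 - 13 * A 1 1 + 19 * A 2 1 - 11 * A 3 1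
        + 7 * A 1 0 - 17 * A 2 0 + 17 * A 3 0 - B 1 + 3 * B 2 - 6 * B 3 := by
    simp only [A, B, Finset.mul_sum, ← Finset.sum_add_distrib, ← Finset.sum_sub_distrib]
    refine Finset.sum_congr rfl fun j hj => ?_
    have hm : q + 1 - j = q - j + 1 := by have := Finset.mem_range.1 hj; omega
    simp only [alpha, hm, Nat.add_sub_cancel, Nat.add_zero, Nat.cast_one, Nat.cast_ofNat, one_pow]
    ring
  rw [hα]
  push_cast at key ⊢
  linarith

/-! ### Coefficient recurrence from the differential equation. -/

section Coefficients

variable {y : ℝ → ℝ} {c : ℝ}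

theorem contDiffOn_of_hasDerivAt
    (hy : ∀ z < 1, HasDerivAt y ((y z - c * (1 - z)) / (1 - z) ^ 2) z) (n : ℕ) :
    ContDiffOn ℝ n y (Set.Iio 1) := by
  induction n with
  | zero => exact contDiffOn_zero.2 fun z hz => (hy z hz).continuousAt.continuousWithinAt
  | succ n ih =>
    push_cast
    rw [contDiffOn_succ_iff_deriv_of_isOpen isOpen_Iio]
    refine ⟨fun z hz => (hy z hz).differentiableAt.differentiableWithinAt, by simp, ?_⟩
    refine ContDiffOn.congr (f := fun z => (y z - c * (1 - z)) / (1 - z) ^ 2) ?_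
      fun z hz => (hy z hz).deriv
    refine ContDiffOn.div (ih.sub ?_) ?_ fun z hz => pow_ne_zero 2 (sub_pos.2 hz).ne'
    · fun_prop
    · fun_prop

theorem hasDerivAt_iteratedDeriv
    (hy : ∀ z < 1, HasDerivAt y ((y z - c * (1 - z)) / (1 - z) ^ 2) z) (n : ℕ) {z : ℝ}
    (hz : z < 1) : HasDerivAt (iteratedDeriv n y) (iteratedDeriv (n + 1) y z) z := by
  have h := (contDiffOn_of_hasDerivAt hy (n + 1)).differentiableOn_iteratedDerivWithin
    (m := n) (by exact_mod_cast n.lt_succ_self) isOpen_Iio.uniqueDiffOn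
  have h1 : DifferentiableAt ℝ (iteratedDeriv n y) z := by
    refine ((h z hz).differentiableAt (Iio_mem_nhds hz)).congr_of_eventuallyEq ?_
    filter_upwards [Iio_mem_nhds hz] with w hw
    exact (iteratedDerivWithin_of_isOpen isOpen_Iio hw).symm
  rw [iteratedDeriv_succ]
  exact h1.hasDerivAt

/-- This is the differential equation differentiated `n + 1` times. The term `-c(1-z)` is linear, so
it leaves `c` at the first differentiation and nothing later. -/
theorem iteratedDeriv_recurrence
    (hy : ∀ z < 1, HasDerivAt y ((y z - c * (1 - z)) / (1 - z) ^ 2) z) (n : ℕ) :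
    ∀ z < 1, (1 - z) ^ 2 * iteratedDeriv (n + 2) y z
      - (2 * (n + 1) * (1 - z) + 1) * iteratedDeriv (n + 1) y z
      + (n + 1) * n * iteratedDeriv n y z = if n = 0 then c else 0 := by
  have hsub : ∀ z : ℝ, HasDerivAt (fun z : ℝ => 1 - z) (-1) z := fun z => by
    simpa using (hasDerivAt_id z).const_sub 1
  induction n with
  | zero =>
    intro z hz
    have h1 := ((hsub z).pow 2).mul (hasDerivAt_iteratedDeriv hy 1 hz)
    have h2 := (hy z hz).sub ((hsub z).const_mul c)
    have h3 : (fun z => y z - c * (1 - z)) =ᶠ[𝓝 z]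
        ((fun z : ℝ => 1 - z) ^ 2 * iteratedDeriv 1 y) := by
      filter_upwards [Iio_mem_nhds hz] with w hw
      have : 1 - w ≠ 0 := (sub_pos.2 hw).ne'
      simp only [Pi.mul_apply, Pi.pow_apply, iteratedDeriv_one, (hy w hw).deriv]
      field_simp
    have h4 := (h1.congr_of_eventuallyEq h3).unique h2
    rw [← (hy z hz).deriv, ← iteratedDeriv_one] at h4
    simp at h4 ⊢
    linarith
  | succ n ih =>
    intro z hz
    have h1 := ((hsub z).pow 2).mul (hasDerivAt_iteratedDeriv hy (n + 2) hz)
    have h2 := (((hsub z).const_mul (2 * ((n : ℝ) + 1))).add_const 1).mul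
      (hasDerivAt_iteratedDeriv hy (n + 1) hz)
    have h3 := (hasDerivAt_iteratedDeriv hy n hz).const_mul (((n : ℝ) + 1) * n)
    have h4 := (h1.sub h2).add h3
    have h5 := h4.congr_of_eventuallyEq (f₁ := fun _ => if n = 0 then c else 0) (by
      filter_upwards [Iio_mem_nhds hz] with w hw
      exact (ih w hw).symm)
    have h6 := h5.unique (hasDerivAt_const z _)
    simp at h6 ⊢
    linarith

theorem maclaurinCoeff_recurrence
    (hy : ∀ z < 1, HasDerivAt y ((y z - c * (1 - z)) / (1 - z) ^ 2) z) (n : ℕ) :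
    (n + 2) * maclaurinCoeff y (n + 2) = (2 * n + 3) * maclaurinCoeff y (n + 1)
      - n * maclaurinCoeff y n + if n = 0 then c else 0 := by
  have h := iteratedDeriv_recurrence hy n 0 one_pos
  have e : (if n = 0 then c else 0) = (if n = 0 then c else 0) / ((n + 1).factorial : ℝ) := by
    split_ifs with h0 <;> simp [h0]
  rw [e, ← h]
  simp only [maclaurinCoeff, Nat.factorial_succ]
  push_cast
  have := Nat.factorial_ne_zero n
  field_simp
  ring

end Coefficients

theorem maclaurinCoeff_one {y : ℝ → ℝ} {y' : ℝ} (h : HasDerivAt y y' 0) :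
    maclaurinCoeff y 1 = y' := by simp [maclaurinCoeff, h.deriv]

/-! ### The two generating functions and an integral for `b_n`. -/

theorem hasDerivAt_f0 (z : ℝ) (hz : z < 1) :
    HasDerivAt f0 ((f0 z - 0 * (1 - z)) / (1 - z) ^ 2) z := by
  have h0 : 1 - z ≠ 0 := (sub_pos.2 hz).ne'
  have h := ((hasDerivAt_id z).div ((hasDerivAt_id z).const_sub 1) h0).exp
  refine h.congr_deriv ?_
  simp [f0]
  field_simp

theorem integrableOn_exp_neg_div {k m : ℕ} (h : m ≤ k) {a : ℝ} (ha : 0 < a) :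
    MeasureTheory.IntegrableOn (fun t : ℝ => Real.exp (-t) * (t - a) ^ m / t ^ k) (Set.Ioi a) := by
  have hi := integrableOn_exp_neg_Ioi a
  refine (hi.div_const (a ^ (k - m))).mono' ?_ ?_
  · refine ContinuousOn.aestronglyMeasurable ?_ measurableSet_Ioi
    refine ContinuousOn.div (by fun_prop) (by fun_prop) fun t ht => ?_
    exact pow_ne_zero _ (ha.trans ht).ne'
  · refine (MeasureTheory.ae_restrict_iff' measurableSet_Ioi).2 (.of_forall fun t ht => ?_)
    have ht : a < t := ht
    have h0 : 0 < t := ha.trans ht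
    have h1 : 0 < t - a := sub_pos.2 ht
    rw [Real.norm_of_nonneg (by positivity), div_le_div_iff₀ (by positivity) (by positivity),
      mul_assoc]
    gcongr
    calc (t - a) ^ m * a ^ (k - m) ≤ t ^ m * t ^ (k - m) := by gcongr; linarith
      _ = t ^ k := by rw [← pow_add, Nat.add_sub_cancel' h]

theorem hasDerivAt_expIntegralE1 {x : ℝ} (hx : 0 < x) :
    HasDerivAt expIntegralE1 (-(Real.exp (-x) / x)) x := by
  have hcont : ContinuousOn (fun t : ℝ => Real.exp (-t) / t) (Set.Ioi 0) :=
    ContinuousOn.div (by fun_prop) (by fun_prop) fun t ht => (ne_of_gt ht)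
  have hint : ∀ a : ℝ, 0 < a →
      MeasureTheory.IntegrableOn (fun t : ℝ => Real.exp (-t) / t) (Set.Ioi a) := fun a ha => by
    simpa using integrableOn_exp_neg_div (Nat.zero_le 1) ha
  have hii : IntervalIntegrable (fun t : ℝ => Real.exp (-t) / t) MeasureTheory.volume (x / 2) x :=
    (intervalIntegrable_iff_integrableOn_Ioc_of_le (by linarith)).2
      ((hint (x / 2) (by positivity)).mono_set Set.Ioc_subset_Ioi_self)
  have h := intervalIntegral.integral_hasDerivAt_right hii
    (hcont.stronglyMeasurableAtFilter isOpen_Ioi x hx) (hcont.continuousAt (Ioi_mem_nhds hx))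
  refine (h.const_sub (expIntegralE1 (x / 2))).congr_of_eventuallyEq ?_
  filter_upwards [Ioi_mem_nhds (half_lt_self hx)] with w hw
  rw [← intervalIntegral.integral_Ioi_sub_Ioi (hint (x / 2) (by positivity)) (le_of_lt hw)]
  simp [expIntegralE1]

theorem hasDerivAt_f1 (z : ℝ) (hz : z < 1) :
    HasDerivAt f1 ((f1 z - 1 * (1 - z)) / (1 - z) ^ 2) z := by
  have h0 : 0 < 1 - z := sub_pos.2 hz
  have hx : HasDerivAt (fun z : ℝ => 1 / (1 - z)) (1 / (1 - z) ^ 2) z := by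
    simpa [Pi.inv_def] using ((hasDerivAt_id z).const_sub 1).inv h0.ne'
  have h := hx.exp.mul
    ((hasDerivAt_expIntegralE1 (x := 1 / (1 - z)) (by positivity)).comp z hx)
  refine h.congr_deriv ?_
  simp only [f1, Function.comp_apply, Real.exp_neg]
  have := Real.exp_pos (1 / (1 - z))
  field_simp
  ring

/-- `∫_1^∞ e^{-t} (t-1)^m t^{-m-2} dt`, equal to `-e^{-1} [z^{m+1}] f₁(z)`. -/
def laplaceMoment (m : ℕ) : ℝ :=
  ∫ t in Set.Ioi (1 : ℝ), Real.exp (-t) * (t - 1) ^ m / t ^ (m + 2)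

theorem integrableOn_laplaceMoment (m : ℕ) : MeasureTheory.IntegrableOn
    (fun t : ℝ => Real.exp (-t) * (t - 1) ^ m / t ^ (m + 2)) (Set.Ioi 1) :=
  integrableOn_exp_neg_div (by omega) one_pos

theorem tendsto_exp_neg_mul_div {k m : ℕ} (h : m ≤ k) :
    Tendsto (fun t : ℝ => Real.exp (-t) * (t - 1) ^ m / t ^ k) atTop (𝓝 0) := by
  refine squeeze_zero_norm' ?_ Real.tendsto_exp_neg_atTop_nhds_zero
  filter_upwards [eventually_ge_atTop 1] with t ht
  have h1 : 0 ≤ t - 1 := sub_nonneg.2 ht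
  rw [Real.norm_of_nonneg (by positivity), div_le_iff₀ (by positivity)]
  gcongr
  exact (pow_le_pow_left₀ h1 (by linarith) m).trans (pow_le_pow_right₀ ht h)

theorem hasDerivAt_exp_neg_mul_div (m k : ℕ) {t : ℝ} (ht : 0 < t) :
    HasDerivAt (fun t : ℝ => Real.exp (-t) * (t - 1) ^ m / t ^ k)
      (((-Real.exp (-t)) * (t - 1) ^ m + Real.exp (-t) * (m * (t - 1) ^ (m - 1))) / t ^ k
        - Real.exp (-t) * (t - 1) ^ m * k / t ^ (k + 1)) t := by
  have h1 : HasDerivAt (fun t : ℝ => Real.exp (-t)) (-Real.exp (-t)) t := by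
    simpa using (hasDerivAt_id t).neg.exp
  have h2 : HasDerivAt (fun t : ℝ => (t - 1) ^ m) (m * (t - 1) ^ (m - 1)) t := by
    simpa using ((hasDerivAt_id t).sub_const 1).fun_pow m
  refine ((h1.mul h2).div (hasDerivAt_pow k t) (by positivity)).congr_deriv ?_
  rcases k with _ | k
  · simp
  · simp only [Pi.mul_apply, Nat.add_sub_cancel]
    field_simp
    push_cast
    ring

/-- The combined integrand is the derivative of `e^{-t}(t-1)^{m+1}/t^{m+3}`, which vanishes at `1`
and at infinity. -/
theorem laplaceMoment_recurrence (m : ℕ) :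
    (m + 3) * laplaceMoment (m + 2) - (2 * m + 5) * laplaceMoment (m + 1)
      + (m + 1) * laplaceMoment m = 0 := by
  have i2 := (integrableOn_laplaceMoment (m + 2)).const_mul ((m : ℝ) + 3)
  have i1 := (integrableOn_laplaceMoment (m + 1)).const_mul (2 * (m : ℝ) + 5)
  have i0 := (integrableOn_laplaceMoment m).const_mul ((m : ℝ) + 1)
  have i21 : MeasureTheory.IntegrableOn (fun t : ℝ =>
      (m + 3) * (Real.exp (-t) * (t - 1) ^ (m + 2) / t ^ (m + 2 + 2))
        - (2 * m + 5) * (Real.exp (-t) * (t - 1) ^ (m + 1) / t ^ (m + 1 + 2))) (Set.Ioi 1) :=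
    i2.sub i1
  have h := MeasureTheory.integral_Ioi_of_hasDerivAt_of_tendsto' (fun t ht =>
    (hasDerivAt_exp_neg_mul_div (m + 1) (m + 3) (one_pos.trans_le ht)).congr_deriv
      (g' := (m + 3) * (Real.exp (-t) * (t - 1) ^ (m + 2) / t ^ (m + 2 + 2))
        - (2 * m + 5) * (Real.exp (-t) * (t - 1) ^ (m + 1) / t ^ (m + 1 + 2))
        + (m + 1) * (Real.exp (-t) * (t - 1) ^ m / t ^ (m + 2))) ?_)
    (i21.add i0) (tendsto_exp_neg_mul_div (by omega))
  · rw [MeasureTheory.integral_add i21 i0, MeasureTheory.integral_sub i2 i1,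
      MeasureTheory.integral_const_mul, MeasureTheory.integral_const_mul,
      MeasureTheory.integral_const_mul] at h
    simpa [laplaceMoment] using h
  · have h0 : t ≠ 0 := (one_pos.trans_le ht).ne'
    simp only [Nat.add_sub_cancel]
    field_simp
    push_cast
    ring

theorem laplaceMoment_zero : laplaceMoment 0 = Real.exp (-1) - expIntegralE1 1 := by
  have i0 := integrableOn_laplaceMoment 0
  have i1 : MeasureTheory.IntegrableOn (fun t : ℝ => Real.exp (-t) / t) (Set.Ioi 1) := by
    simpa using integrableOn_exp_neg_div (Nat.zero_le 1) one_pos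
  have h := MeasureTheory.integral_Ioi_of_hasDerivAt_of_tendsto' (fun t ht =>
    (hasDerivAt_exp_neg_mul_div 0 1 (one_pos.trans_le ht)).congr_deriv
      (g' := -(Real.exp (-t) * (t - 1) ^ 0 / t ^ (0 + 2) + Real.exp (-t) / t)) ?_)
    (i0.add i1).neg (tendsto_exp_neg_mul_div (by omega))
  · rw [MeasureTheory.integral_neg, MeasureTheory.integral_add i0 i1] at h
    simp only [laplaceMoment, expIntegralE1]
    simp at h ⊢
    linarith
  · have h0 : t ≠ 0 := (one_pos.trans_le ht).ne'
    simp
    field_simp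
    ring

theorem laplaceMoment_one : 2 * laplaceMoment 1 = 3 * laplaceMoment 0 - Real.exp (-1) := by
  have i1 := (integrableOn_laplaceMoment 1).const_mul 2
  have i0 := (integrableOn_laplaceMoment 0).const_mul 3
  have i10 : MeasureTheory.IntegrableOn (fun t : ℝ =>
      2 * (Real.exp (-t) * (t - 1) ^ 1 / t ^ (1 + 2))
        - 3 * (Real.exp (-t) * (t - 1) ^ 0 / t ^ (0 + 2))) (Set.Ioi 1) := i1.sub i0
  have h := MeasureTheory.integral_Ioi_of_hasDerivAt_of_tendsto' (fun t ht =>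
    (hasDerivAt_exp_neg_mul_div 0 2 (one_pos.trans_le ht)).congr_deriv
      (g' := 2 * (Real.exp (-t) * (t - 1) ^ 1 / t ^ (1 + 2))
        - 3 * (Real.exp (-t) * (t - 1) ^ 0 / t ^ (0 + 2))) ?_)
    i10 (tendsto_exp_neg_mul_div (by omega))
  · rw [MeasureTheory.integral_sub i1 i0, MeasureTheory.integral_const_mul,
      MeasureTheory.integral_const_mul] at h
    simp only [laplaceMoment]
    simp at h ⊢
    linarith
  · have h0 : t ≠ 0 := (one_pos.trans_le ht).ne'
    simp
    field_simp
    ring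

theorem setIntegral_Ioi_pos {f : ℝ → ℝ} {a : ℝ} (hf : ∀ t, a < t → 0 < f t)
    (hi : MeasureTheory.IntegrableOn f (Set.Ioi a)) : 0 < ∫ t in Set.Ioi a, f t := by
  rw [MeasureTheory.setIntegral_pos_iff_support_of_nonneg_ae
    ((MeasureTheory.ae_restrict_iff' measurableSet_Ioi).2 (.of_forall fun t ht => (hf t ht).le)) hi]
  have : Set.Ioi a ⊆ Function.support f := fun t ht => (hf t ht).ne'
  rw [Set.inter_eq_right.2 this]
  simp

theorem laplaceMoment_pos (m : ℕ) : 0 < laplaceMoment m := by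
  refine setIntegral_Ioi_pos (fun t ht => ?_) (integrableOn_laplaceMoment m)
  have h1 : 0 < t - 1 := sub_pos.2 ht
  have h2 : 0 < t := one_pos.trans ht
  positivity

/-- Consecutive integrands differ by the factor `(t-1)/t < 1`. -/
theorem laplaceMoment_succ_lt (m : ℕ) : laplaceMoment (m + 1) < laplaceMoment m := by
  rw [← sub_pos, laplaceMoment, laplaceMoment, ← MeasureTheory.integral_sub
    (integrableOn_laplaceMoment m) (integrableOn_laplaceMoment (m + 1))]
  refine setIntegral_Ioi_pos (fun t ht => ?_)
    ((integrableOn_laplaceMoment m).sub (integrableOn_laplaceMoment (m + 1)))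
  have h1 : 0 < t - 1 := sub_pos.2 ht
  have h2 : 0 < t := one_pos.trans ht
  have : Real.exp (-t) * (t - 1) ^ m / t ^ (m + 2)
      - Real.exp (-t) * (t - 1) ^ (m + 1) / t ^ (m + 1 + 2)
      = Real.exp (-t) * (t - 1) ^ m / t ^ (m + 3) := by
    field_simp
    ring
  rw [this]
  positivity

/-! ### Signs, monotonicity and the Casoratian. -/

theorem maclaurinCoeff_f0_one : maclaurinCoeff f0 1 = 1 := by
  rw [maclaurinCoeff_one (hasDerivAt_f0 0 one_pos)]
  simp [f0]

/-- Both sides satisfy the same three-term recurrence and agree at the first two indices. The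
integral makes sign and monotonicity of `b_n` visible, which the recurrence alone does not. -/
theorem maclaurinCoeff_f1_succ (m : ℕ) :
    maclaurinCoeff f1 (m + 1) = -(Real.exp 1 * laplaceMoment m) := by
  have he : Real.exp 1 * Real.exp (-1) = 1 := by rw [← Real.exp_add]; simp
  have h0 : maclaurinCoeff f1 1 = -(Real.exp 1 * laplaceMoment 0) := by
    rw [maclaurinCoeff_one (hasDerivAt_f1 0 one_pos), laplaceMoment_zero]
    simp [f1]
    linarith
  induction m using Nat.twoStepInduction with
  | zero => exact h0
  | one =>
    have h := maclaurinCoeff_recurrence hasDerivAt_f1 0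
    have h1 := laplaceMoment_one
    simp [h0] at h ⊢
    linear_combination h / 2 + Real.exp 1 * h1 / 2 - he / 2
  | more m ih0 ih1 =>
    have h := maclaurinCoeff_recurrence hasDerivAt_f1 (m + 1)
    have h1 := laplaceMoment_recurrence m
    rw [ih0, ih1] at h
    have h3 : (m : ℝ) + 3 ≠ 0 := by positivity
    rw [if_neg (by omega)] at h
    push_cast at h
    refine mul_left_cancel₀ h3 ?_
    linear_combination h + Real.exp 1 * h1

theorem maclaurinCoeff_f1_neg (m : ℕ) : maclaurinCoeff f1 (m + 1) < 0 := by
  rw [maclaurinCoeff_f1_succ, neg_lt_zero]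
  exact mul_pos (Real.exp_pos 1) (laplaceMoment_pos m)

theorem maclaurinCoeff_f1_lt (m : ℕ) : maclaurinCoeff f1 (m + 1) < maclaurinCoeff f1 (m + 2) := by
  rw [maclaurinCoeff_f1_succ, maclaurinCoeff_f1_succ, neg_lt_neg_iff]
  exact mul_lt_mul_of_pos_left (laplaceMoment_succ_lt m) (Real.exp_pos 1)

theorem maclaurinCoeff_f0_pos_le (m : ℕ) :
    0 < maclaurinCoeff f0 (m + 1) ∧ maclaurinCoeff f0 (m + 1) ≤ maclaurinCoeff f0 (m + 2) := by
  induction m with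
  | zero =>
    have h := maclaurinCoeff_recurrence hasDerivAt_f0 0
    simp [maclaurinCoeff_f0_one] at h ⊢
    linarith
  | succ m ih =>
    have h := maclaurinCoeff_recurrence hasDerivAt_f0 (m + 1)
    refine ⟨ih.1.trans_le ih.2, ?_⟩
    simp at h
    have hm : (0 : ℝ) ≤ m := Nat.cast_nonneg m
    nlinarith [mul_le_mul_of_nonneg_left ih.2 hm]

/-- The recurrence multiplies the Casoratian by `(m+1)/(m+3)` at each step; the initial value comes
from the inhomogeneity `c = 1` of `f1`. -/
theorem casoratian (m : ℕ) :
    maclaurinCoeff f0 (m + 2) * maclaurinCoeff f1 (m + 1)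
      - maclaurinCoeff f0 (m + 1) * maclaurinCoeff f1 (m + 2) = -1 / ((m + 1) * (m + 2)) := by
  induction m with
  | zero =>
    have h := maclaurinCoeff_recurrence hasDerivAt_f0 0
    have h1 := maclaurinCoeff_recurrence hasDerivAt_f1 0
    simp [maclaurinCoeff_f0_one] at h h1 ⊢
    linear_combination maclaurinCoeff f1 1 * h / 2 - h1 / 2
  | succ m ih =>
    have h := maclaurinCoeff_recurrence hasDerivAt_f0 (m + 1)
    have h1 := maclaurinCoeff_recurrence hasDerivAt_f1 (m + 1)
    rw [if_neg (by omega)] at h h1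
    push_cast at h h1 ⊢
    rw [eq_div_iff (by positivity)] at ih ⊢
    have h2 : (m : ℝ) + 1 ≠ 0 := by positivity
    linear_combination (m + 2) * maclaurinCoeff f1 (m + 2) * h
      - (m + 2) * maclaurinCoeff f0 (m + 2) * h1 + ih

/-! ### Two stability lemmas for perturbed contractions. -/

theorem one_add_pow_le_one_add_mul {x : ℝ} (h0 : 0 ≤ x) (h1 : x ≤ 1) (p : ℕ) :
    (1 + x) ^ p ≤ 1 + (2 ^ p - 1) * x := by
  induction p with
  | zero => simp
  | succ p ih =>
    have h2 : (1 : ℝ) ≤ 2 ^ p := one_le_pow₀ one_le_two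
    have h3 : (2 ^ p - 1) * x * x ≤ (2 ^ p - 1) * x :=
      mul_le_of_le_one_right (mul_nonneg (by linarith) h0) h1
    calc (1 + x) ^ (p + 1) ≤ (1 + (2 ^ p - 1) * x) * (1 + x) := by
          rw [pow_succ]; gcongr
      _ = 1 + (2 ^ p) * x + (2 ^ p - 1) * x * x := by ring
      _ ≤ _ := by rw [pow_succ]; linarith

/-- A factor `1 + q/n` with `q` large enough outweighs the growth of `n^p`, so `n^p e_n` stays
bounded. -/
theorem isBigO_of_forward_contraction {e : ℕ → ℝ} {C : ℝ} {p : ℕ} (he : ∀ n, 0 ≤ e n) (hC : 0 ≤ C)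
    (h : ∀ q : ℕ, ∀ᶠ n : ℕ in atTop, (1 + q / (n : ℝ)) * e (n + 1) ≤ e n + C / (n : ℝ) ^ (p + 1)) :
    e =O[atTop] fun n : ℕ => 1 / (n : ℝ) ^ p := by
  -- Here `2^p` pays for `(1 + 1/n)^p ≤ 1 + 2^p/n`, and the extra `1` absorbs the error `C/n^{p+1}`.
  obtain ⟨N, hN⟩ := eventually_atTop.1 ((h (2 ^ p + 1)).and (eventually_ge_atTop 1))
  set K := max ((N : ℝ) ^ p * e N) (C * (1 + 2 ^ p)) with hK
  have key : ∀ n ≥ N, (n : ℝ) ^ p * e n ≤ K := by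
    intro n hn
    induction n, hn using Nat.le_induction with
    | base => exact le_max_left _ _
    | succ n hn ih =>
      obtain ⟨h1, h2⟩ := hN n hn
      have hn0 : (0 : ℝ) < n := by exact_mod_cast h2
      have hx1 : 1 / (n : ℝ) ≤ 1 := by
        rw [div_le_one hn0]; exact_mod_cast h2
      have hx0 : 0 < 1 / (n : ℝ) := by positivity
      have hpow : ((n + 1 : ℕ) : ℝ) ^ p ≤ (n : ℝ) ^ p * (1 + 2 ^ p * (1 / n)) := by
        calc ((n + 1 : ℕ) : ℝ) ^ p = (n : ℝ) ^ p * (1 + 1 / n) ^ p := by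
              rw [← mul_pow]; congr 1; push_cast; field_simp
          _ ≤ _ := by
            gcongr
            refine (one_add_pow_le_one_add_mul hx0.le hx1 p).trans ?_
            linarith
      set x := 1 / (n : ℝ) with hx
      have h3 : (n : ℝ) ^ p * (C / (n : ℝ) ^ (p + 1)) = C * x := by
        rw [hx, pow_succ]; field_simp
      have h4 : C * (1 + 2 ^ p) ≤ K := le_max_right _ _
      have h5 : (1 + 2 ^ p * x) * (K + C * x) ≤ K * (1 + (2 ^ p + 1) * x) := by
        have : C * x * (2 ^ p * x) ≤ C * x * (2 ^ p * 1) := by gcongr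
        have := mul_le_mul_of_nonneg_right h4 hx0.le
        linarith
      have h6 : (((n + 1 : ℕ) : ℝ) ^ p * e (n + 1)) * (1 + (2 ^ p + 1) * x)
          ≤ K * (1 + (2 ^ p + 1) * x) := by
        refine le_trans ?_ h5
        have h1' : (1 + (2 ^ p + 1) * x) * e (n + 1) ≤ e n + C / (n : ℝ) ^ (p + 1) := by
          refine le_trans (le_of_eq ?_) h1
          rw [hx]; push_cast; ring
        have hr : 0 ≤ e n + C / (n : ℝ) ^ (p + 1) := add_nonneg (he n) (by positivity)
        have hl : 0 ≤ (1 + (2 ^ p + 1) * x) * e (n + 1) := mul_nonneg (by positivity) (he _)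
        calc ((n + 1 : ℕ) : ℝ) ^ p * e (n + 1) * (1 + (2 ^ p + 1) * x)
            = ((n + 1 : ℕ) : ℝ) ^ p * ((1 + (2 ^ p + 1) * x) * e (n + 1)) := by ring
          _ ≤ ((n : ℝ) ^ p * (1 + 2 ^ p * x)) * (e n + C / (n : ℝ) ^ (p + 1)) := by gcongr
          _ = (1 + 2 ^ p * x) * ((n : ℝ) ^ p * e n + C * x) := by rw [← h3]; ring
          _ ≤ (1 + 2 ^ p * x) * (K + C * x) := by gcongr
      exact le_of_mul_le_mul_right h6 (by positivity)
  refine IsBigO.of_bound K ?_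
  filter_upwards [eventually_ge_atTop N] with n hn
  have hn0 : (0 : ℝ) < n := by exact_mod_cast (hN n hn).2
  rw [Real.norm_of_nonneg (he n), Real.norm_of_nonneg (by positivity), mul_one_div,
    le_div_iff₀ (by positivity), mul_comm]
  exact key n hn

/-- With `δ_n = e_n - C/n^p`, the quotient `δ_n/n` is eventually nondecreasing. A positive `δ_n`
would force linear growth of `e`, against boundedness. -/
theorem isBigO_of_backward_contraction {e : ℕ → ℝ} {C B : ℝ} {p : ℕ} (he : ∀ n, 0 ≤ e n)
    (hC : 0 ≤ C) (hB : ∀ᶠ n in atTop, e n ≤ B)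
    (h : ∀ᶠ n : ℕ in atTop, (1 + 1 / (n : ℝ)) * e n ≤ e (n + 1) + C / (n : ℝ) ^ (p + 1)) :
    e =O[atTop] fun n : ℕ => 1 / (n : ℝ) ^ p := by
  obtain ⟨N, hN⟩ := eventually_atTop.1 ((h.and hB).and (eventually_ge_atTop 1))
  set δ : ℕ → ℝ := fun n => e n - C / (n : ℝ) ^ p with hδ
  have step : ∀ n ≥ N, (n + 1) * δ n ≤ n * δ (n + 1) := by
    intro n hn
    obtain ⟨⟨h1, -⟩, h2⟩ := hN n hn
    have hn0 : (0 : ℝ) < n := by exact_mod_cast h2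
    have h3 : C / ((n + 1 : ℕ) : ℝ) ^ p ≤ C / (n : ℝ) ^ p := by
      gcongr; exact_mod_cast n.le_succ
    have h4 := mul_le_mul_of_nonneg_left h1 hn0.le
    have h5 : (n : ℝ) * (C / (n : ℝ) ^ (p + 1)) = C / (n : ℝ) ^ p := by
      rw [pow_succ]; field_simp
    have h6 : (n : ℝ) * ((1 + 1 / (n : ℝ)) * e n) = (n + 1) * e n := by field_simp
    have h7 := mul_le_mul_of_nonneg_left h3 hn0.le
    simp only [hδ]
    linarith
  have mono : ∀ n ≥ N, ∀ m ≥ n, m * δ n ≤ n * δ m := by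
    intro n hn m hm
    induction m, hm using Nat.le_induction with
    | base => exact le_rfl
    | succ m hm ih =>
      have hm0 : (0 : ℝ) < m := by exact_mod_cast (hN m (hn.trans hm)).2
      have h1 := step m (hn.trans hm)
      have h2 := mul_le_mul_of_nonneg_left h1 (Nat.cast_nonneg (α := ℝ) n)
      have h3 := mul_le_mul_of_nonneg_left ih (by positivity : (0 : ℝ) ≤ (m : ℝ) + 1)
      push_cast
      refine le_of_mul_le_mul_left ?_ hm0
      linarith
  refine IsBigO.of_bound C ?_
  filter_upwards [eventually_ge_atTop N] with n hn
  rw [Real.norm_of_nonneg (he n), Real.norm_of_nonneg (by positivity), mul_one_div]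
  by_contra! hcon
  have hpos : 0 < δ n := sub_pos.2 hcon
  obtain ⟨m, hm⟩ := exists_nat_gt (n * B / δ n)
  have hm' : n * B < (max m n : ℕ) * δ n := by
    rw [div_lt_iff₀ hpos] at hm
    refine hm.trans_le ?_
    gcongr
    exact le_max_left _ _
  have h1 := mono n hn (max m n) (le_max_right _ _)
  have h2 : δ (max m n) ≤ B := by
    have := (hN (max m n) (hn.trans (le_max_right _ _))).1.2
    have h3 : 0 ≤ C / ((max m n : ℕ) : ℝ) ^ p := by positivity
    simp only [hδ]
    linarith
  have h3 := mul_le_mul_of_nonneg_left h2 (Nat.cast_nonneg (α := ℝ) n)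
  linarith

/-! ### Approximate solutions of the Riccati equation. -/

/-- If `t = n^{-1/2}`, then `t * sqrtRatio t = (n-1)^{-1/2}`. -/
def sqrtRatio (t : ℝ) : ℝ := 1 / √(1 - t ^ 2)

/-- The defect of `g` in the Riccati equation for the ratios of consecutive coefficients,
written in the variable `t = n^{-1/2}`. -/
def riccatiDefect (g : ℝ → ℝ) (t : ℝ) : ℝ :=
  (1 + t ^ 2) * g t * g (t * sqrtRatio t) - (2 + t ^ 2) * g (t * sqrtRatio t) + (1 - t ^ 2)

theorem analyticAt_sqrtRatio : AnalyticAt ℝ sqrtRatio 0 := by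
  have h1 : AnalyticAt ℝ Real.sqrt (1 - (0 : ℝ) ^ 2) :=
    (Real.contDiffAt_sqrt (by norm_num)).analyticAt
  have h2 : AnalyticAt ℝ (fun t : ℝ => √(1 - t ^ 2)) 0 :=
    AnalyticAt.fun_comp (f := fun t : ℝ => 1 - t ^ 2) h1 (by fun_prop)
  exact analyticAt_const.div h2 (by simp)

@[simp] theorem sqrtRatio_zero : sqrtRatio 0 = 1 := by simp [sqrtRatio]

theorem sqrtRatio_pos {t : ℝ} (ht : |t| < 1) : 0 < sqrtRatio t := by
  have : 0 < 1 - t ^ 2 := by rw [sub_pos]; exact (sq_lt_one_iff_abs_lt_one t).2 ht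
  exact one_div_pos.2 (Real.sqrt_pos.2 this)

theorem sqrtRatio_sub_one {t : ℝ} (ht : |t| < 1) :
    sqrtRatio t - 1 = t ^ 2 * (sqrtRatio t ^ 2 / (sqrtRatio t + 1)) := by
  have h0 : 0 < 1 - t ^ 2 := by rw [sub_pos]; exact (sq_lt_one_iff_abs_lt_one t).2 ht
  have h1 : sqrtRatio t ^ 2 * (1 - t ^ 2) = 1 := by
    rw [sqrtRatio, div_pow, Real.sq_sqrt h0.le]
    field_simp
  have h2 := sqrtRatio_pos ht
  field_simp
  linarith

theorem AnalyticAt.exists_eq_mul {f : ℝ → ℝ} (hf : AnalyticAt ℝ f 0) (h0 : f 0 = 0) :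
    ∃ φ, AnalyticAt ℝ φ 0 ∧ ∀ᶠ t in 𝓝 0, f t = t * φ t := by
  have h1 : ((1 : ℕ) : ℕ∞) ≤ analyticOrderAt f 0 := by
    rw [Nat.cast_one, Order.one_le_iff_ne_zero]
    exact hf.analyticOrderAt_ne_zero.2 h0
  obtain ⟨φ, hφ, h⟩ := (natCast_le_analyticOrderAt hf).1 h1
  exact ⟨φ, hφ, by simpa using h⟩

open Polynomial in
-- Newton-style correction: adding `c t^{N+2}` to the approximation changes the defect by `c t^{N+3}
-- ψ(t)`. The order `t^{N+2}` drops out because `sqrtRatio t - 1 = O(t²)`.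
theorem exists_riccatiDefect_eq (N : ℕ) : ∃ (h : ℝ[X]) (φ : ℝ → ℝ), AnalyticAt ℝ φ 0 ∧
    ∀ᶠ t in 𝓝 0, riccatiDefect (fun t => 1 + t + t ^ 2 * h.eval t) t = t ^ (N + 3) * φ t := by
  have hw := analyticAt_sqrtRatio
  have hω : AnalyticAt ℝ (fun t => sqrtRatio t ^ 2 / (sqrtRatio t + 1)) 0 :=
    (hw.fun_pow 2).fun_div (hw.fun_add analyticAt_const) (by simp)
  set ω : ℝ → ℝ := fun t => sqrtRatio t ^ 2 / (sqrtRatio t + 1) with hω_def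
  have hlt : ∀ᶠ t : ℝ in 𝓝 0, |t| < 1 := by
    have : Tendsto (fun t : ℝ => |t|) (𝓝 0) (𝓝 |0|) := continuous_abs.tendsto 0
    exact this.eventually_lt_const (by simp)
  induction N with
  | zero =>
    refine ⟨0, fun t => 1 - ω t + t * ω t + t * sqrtRatio t, by fun_prop, ?_⟩
    filter_upwards [hlt] with t ht
    have h1 := sqrtRatio_sub_one ht
    simp only [riccatiDefect, eval_zero]
    linear_combination (t ^ 2 - t) * h1
  | succ N ih =>
    obtain ⟨h, φ, hφ, heq⟩ := ih
    -- As `ψ 0 = 2`, this choice makes `φ + cψ` vanish at `0`, gaining one order.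
    set c : ℝ := -(φ 0) / 2 with hc
    set ψ : ℝ → ℝ := fun t => -(t * ω t * ∑ i ∈ Finset.range (N + 2), sqrtRatio t ^ i) + t
      + (1 + t ^ 2) * (sqrtRatio t * (1 + t * sqrtRatio t * h.eval (t * sqrtRatio t))
        + (1 + t * h.eval t) * sqrtRatio t ^ (N + 2) + c * t ^ (N + 1) * sqrtRatio t ^ (N + 2))
      with hψ
    have hpoly : ∀ {f : ℝ → ℝ}, AnalyticAt ℝ f 0 → AnalyticAt ℝ (fun t => h.eval (f t)) 0 :=
      fun hf => by simpa using hf.aeval_polynomial h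
    have hψa : AnalyticAt ℝ ψ 0 := by
      have h1 := hpoly (analyticAt_id.fun_mul hw)
      have h2 := hpoly (analyticAt_id (𝕜 := ℝ) (z := 0))
      simp only [id] at h1 h2
      have h3 : AnalyticAt ℝ (fun t => ∑ i ∈ Finset.range (N + 2), sqrtRatio t ^ i) 0 :=
        Finset.analyticAt_fun_sum _ fun i _ => hw.fun_pow i
      fun_prop
    obtain ⟨φ', hφ', heq'⟩ := (hφ.fun_add (analyticAt_const.fun_mul hψa)).exists_eq_mul
      (f := fun t => φ t + c * ψ t) (by simp [hψ, hc]; ring)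
    refine ⟨h + C c * X ^ N, φ', hφ', ?_⟩
    filter_upwards [hlt, heq, heq'] with t ht h1 h2
    have h3 := sqrtRatio_sub_one ht
    have h4 := geom_sum_mul (sqrtRatio t) (N + 2)
    have h5 : t ^ (N + 1 + 3) * φ' t = t ^ (N + 3) * (φ t + c * ψ t) := by rw [h2]; ring
    rw [h5, mul_add, ← h1]
    simp only [riccatiDefect, hψ, eval_add, eval_mul, eval_C, eval_pow, eval_X]
    have h6 : sqrtRatio t ^ (N + 2)
        = 1 + t ^ 2 * ω t * ∑ i ∈ Finset.range (N + 2), sqrtRatio t ^ i := by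
      rw [h3] at h4
      linear_combination -h4
    have h7 : (t * sqrtRatio t) ^ 2 * (t * sqrtRatio t) ^ N = t ^ (N + 2) * sqrtRatio t ^ (N + 2) := by
      ring
    generalize h.eval (t * sqrtRatio t) = H at *
    linear_combination (-c * t ^ (N + 2)) * h6 +
      (c * ((1 + t ^ 2) * (1 + t + t ^ 2 * (h.eval t + c * t ^ N)) - (2 + t ^ 2))) * h7

theorem tendsto_div_sqrt_natCast (ε : ℝ) : Tendsto (fun n : ℕ => ε / √(n : ℝ)) atTop (𝓝 0) :=
  tendsto_const_nhds.div_atTop (Real.tendsto_sqrt_atTop.comp tendsto_natCast_atTop_atTop)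

theorem div_sqrt_mul_sqrtRatio (ε : ℝ) (hε : ε ^ 2 = 1) {n : ℕ} (hn : 1 ≤ n) :
    ε / √((n + 1 : ℕ) : ℝ) * sqrtRatio (ε / √((n + 1 : ℕ) : ℝ)) = ε / √(n : ℝ) := by
  have hn0 : (0 : ℝ) < n := by exact_mod_cast hn
  have h1 : (0 : ℝ) < ((n + 1 : ℕ) : ℝ) := by positivity
  have h2 : 1 - (ε / √((n + 1 : ℕ) : ℝ)) ^ 2 = n / ((n + 1 : ℕ) : ℝ) := by
    rw [div_pow, hε, Real.sq_sqrt h1.le]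
    push_cast
    field_simp
    ring
  rw [sqrtRatio, h2, Real.sqrt_div hn0.le]
  have := Real.sqrt_pos.2 hn0
  have := Real.sqrt_pos.2 h1
  field_simp

/-- The defect of a sequence in the Riccati equation for ratios of consecutive coefficients. -/
def ratioDefect (G : ℕ → ℝ) (n : ℕ) : ℝ :=
  (n + 2) * (G (n + 1) * G n) - (2 * n + 3) * G n + n

open Polynomial in
/-- Approximate solutions of the Riccati equation to every order, as polynomials
in `± n^{-1/2}`. -/
theorem exists_ratioDefect_isBigO (p : ℕ) : ∃ h : ℝ[X], ∀ ε : ℝ, ε ^ 2 = 1 →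
    ratioDefect (fun n : ℕ => 1 + ε / √(n : ℝ) + (ε / √(n : ℝ)) ^ 2 * h.eval (ε / √(n : ℝ)))
      =O[atTop] fun n : ℕ => 1 / (n : ℝ) ^ p := by
  -- Order `t^{2p+2}` suffices: the equation is multiplied by `n + 1 = t^{-2}`, which leaves
  -- `n^{-p}` up to the index shift.
  obtain ⟨h, φ, hφ, heq⟩ := exists_riccatiDefect_eq (2 * p)
  refine ⟨h, fun ε hε => ?_⟩
  set g : ℝ → ℝ := fun t => 1 + t + t ^ 2 * h.eval t with hg
  have h1 : (fun t => riccatiDefect g t) =O[𝓝 0] fun t => t ^ (2 * p + 2) := by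
    have h2 : (fun t => t * φ t) =O[𝓝 0] fun _ => (1 : ℝ) :=
      (continuousAt_id.mul hφ.continuousAt).isBigO_one ℝ
    refine ((isBigO_refl (fun t : ℝ => t ^ (2 * p + 2)) (𝓝 0)).mul h2).congr' ?_ (by simp)
    filter_upwards [heq] with t ht
    rw [ht]
    ring
  have htend : Tendsto (fun n : ℕ => ε / √((n + 1 : ℕ) : ℝ)) atTop (𝓝 0) :=
    (tendsto_div_sqrt_natCast ε).comp (tendsto_add_atTop_nat 1)
  have h2 : (fun n : ℕ => ((n : ℝ) + 1) * riccatiDefect g (ε / √((n + 1 : ℕ) : ℝ))) =O[atTop]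
      fun n : ℕ => 1 / ((n + 1 : ℕ) : ℝ) ^ p := by
    refine ((isBigO_refl (fun n : ℕ => (n : ℝ) + 1) atTop).mul
      (h1.comp_tendsto htend)).congr_right fun n => ?_
    have hn : (0 : ℝ) < (n : ℝ) + 1 := by positivity
    rw [Function.comp_apply, show 2 * p + 2 = 2 * (p + 1) by ring, pow_mul, div_pow, hε,
      Real.sq_sqrt (by positivity), div_pow, one_pow, pow_succ]
    push_cast
    field_simp
  have h3 : (fun n : ℕ => 1 / ((n + 1 : ℕ) : ℝ) ^ p) =O[atTop] fun n : ℕ => 1 / (n : ℝ) ^ p := by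
    refine IsBigO.of_bound 1 ?_
    filter_upwards [eventually_ge_atTop 1] with n hn
    have hn0 : (0 : ℝ) < n := by exact_mod_cast hn
    rw [Real.norm_of_nonneg (by positivity), Real.norm_of_nonneg (by positivity), one_mul]
    gcongr
    exact_mod_cast n.le_succ
  refine (h2.trans h3).congr' ?_ EventuallyEq.rfl
  filter_upwards [eventually_ge_atTop 1] with n hn
  have hn0 : (0 : ℝ) < (n : ℝ) + 1 := by positivity
  have h4 : (ε / √((n + 1 : ℕ) : ℝ)) ^ 2 = 1 / ((n : ℝ) + 1) := by
    rw [div_pow, hε, Real.sq_sqrt (by positivity)]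
    push_cast
    rfl
  rw [riccatiDefect, div_sqrt_mul_sqrtRatio ε hε hn, h4]
  change _ = ((n : ℝ) + 2) * (g (ε / √((n + 1 : ℕ) : ℝ)) * g (ε / √(n : ℝ)))
    - (2 * n + 3) * g (ε / √(n : ℝ)) + n
  field_simp
  ring

open Polynomial in
-- The term `ε/√n` dominates everything of order `1/n`, so each branch departs from `1` by more than
-- any `q/n`, in the direction of `ε`.
theorem eventually_mul_le_add_sq_mul_eval (h : ℝ[X]) (ε : ℝ) (hε : ε ^ 2 = 1) (q : ℕ) :
    ∀ᶠ n : ℕ in atTop, (q : ℝ) / n ≤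
      1 / √(n : ℝ) + ε * ((ε / √(n : ℝ)) ^ 2 * h.eval (ε / √(n : ℝ))) := by
  have h1 : Tendsto (fun n : ℕ => 1 / √(n : ℝ) * (q - ε * h.eval (ε / √(n : ℝ)))) atTop (𝓝 0) := by
    have h2 : Tendsto (fun n : ℕ => (q : ℝ) - ε * h.eval (ε / √(n : ℝ))) atTop
        (𝓝 (q - ε * h.eval 0)) :=
      (((h.continuous.tendsto 0).comp (tendsto_div_sqrt_natCast ε)).const_mul ε).const_sub _
    simpa using (tendsto_div_sqrt_natCast 1).mul h2
  filter_upwards [h1.eventually_le_const one_pos, eventually_ge_atTop 1] with n hn hn1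
  have hn0 : (0 : ℝ) < n := by exact_mod_cast hn1
  have h3 := mul_le_mul_of_nonneg_left hn (by positivity : 0 ≤ 1 / √(n : ℝ))
  have h4 : 1 / √(n : ℝ) * (1 / √(n : ℝ)) = 1 / n := by
    rw [div_mul_div_comm, Real.mul_self_sqrt hn0.le, one_mul]
  rw [← mul_assoc, h4] at h3
  rw [div_pow, hε, Real.sq_sqrt hn0.le, div_eq_mul_one_div]
  linarith

/-! ### Exact ratios against approximate ones. -/

theorem sub_isBigO_of_one_le_ratio {r G : ℕ → ℝ} {p : ℕ} (hr : ∀ᶠ n in atTop, 1 ≤ r n)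
    (hr0 : ∀ᶠ n in atTop, ratioDefect r n = 0)
    (hG : ∀ q : ℕ, ∀ᶠ n : ℕ in atTop, 1 + q / (n : ℝ) ≤ G n)
    (hG0 : ratioDefect G =O[atTop] fun n : ℕ => 1 / (n : ℝ) ^ p) :
    (fun n => r n - G n) =O[atTop] fun n : ℕ => 1 / (n : ℝ) ^ p := by
  obtain ⟨C, hC, hCb⟩ := hG0.exists_pos
  refine IsBigO.of_norm_left (isBigO_of_forward_contraction (C := C) (fun n => norm_nonneg _)
    hC.le fun q => ?_)
  filter_upwards [hr, hr0, hG q, hCb.bound, eventually_ge_atTop 1] with n h1 h2 h3 h4 hn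
  have hn0 : (0 : ℝ) < n := by exact_mod_cast hn
  rw [Real.norm_of_nonneg (by positivity : 0 ≤ 1 / (n : ℝ) ^ p), Real.norm_eq_abs,
    mul_one_div] at h4
  simp only [Real.norm_eq_abs]
  have hrn : 0 < r n := one_pos.trans_le h1
  have hGn : 0 < G n := lt_of_lt_of_le (by positivity) h3
  -- Difference of the two Riccati equations, solved for the error at `n + 1`; the coefficient `n /
  -- r n` is at most `n` as `r n ≥ 1`.
  have key : (n + 2) * G n * (r (n + 1) - G (n + 1)) = n / r n * (r n - G n) - ratioDefect G n := by
    have h5 : ((2 * n + 3) - (n + 2) * r (n + 1)) = n / r n := by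
      rw [eq_div_iff hrn.ne']
      simp only [ratioDefect] at h2
      linarith
    rw [← h5]
    simp only [ratioDefect] at h2 ⊢
    linarith
  have h6 : n * (1 + q / n) * |r (n + 1) - G (n + 1)| ≤ n * |r n - G n| + C / (n : ℝ) ^ p := by
    calc n * (1 + q / n) * |r (n + 1) - G (n + 1)|
        ≤ (n + 2) * G n * |r (n + 1) - G (n + 1)| := by gcongr; linarith
      _ = |(n + 2) * G n * (r (n + 1) - G (n + 1))| := by
        rw [abs_mul, abs_of_pos (by positivity : 0 < (n + 2) * G n)]
      _ ≤ n / r n * |r n - G n| + |ratioDefect G n| := by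
        rw [key]
        refine (abs_sub _ _).trans ?_
        rw [abs_mul, abs_of_pos (by positivity : 0 < n / r n)]
      _ ≤ _ := by
        gcongr
        exact div_le_self hn0.le h1
  refine le_of_mul_le_mul_left ?_ hn0
  refine (le_of_eq (by ring)).trans (h6.trans (le_of_eq ?_))
  rw [pow_succ]
  field_simp

theorem sub_isBigO_of_ratio_lt_one {s G : ℕ → ℝ} {p : ℕ} (hs : ∀ᶠ n in atTop, 0 < s n ∧ s n < 1)
    (hs0 : ∀ᶠ n in atTop, ratioDefect s n = 0)
    (hG : ∀ q : ℕ, ∀ᶠ n : ℕ in atTop, G n ≤ 1 - q / (n : ℝ))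
    (hGb : Tendsto G atTop (𝓝 1))
    (hG0 : ratioDefect G =O[atTop] fun n : ℕ => 1 / (n : ℝ) ^ p) :
    (fun n => s n - G n) =O[atTop] fun n : ℕ => 1 / (n : ℝ) ^ p := by
  obtain ⟨C, hC, hCb⟩ := hG0.exists_pos
  refine IsBigO.of_norm_left (isBigO_of_backward_contraction (C := C) (B := 3)
    (fun n => norm_nonneg _) hC.le ?_ ?_)
  · filter_upwards [hs, hGb.eventually_le_const one_lt_two,
      hGb.eventually_const_le zero_lt_one] with n h1 h2 h3
    rw [Real.norm_eq_abs, abs_le]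
    constructor <;> linarith
  -- Taking `q = 3` at `n + 1` yields `D ≥ n + 4`, and `(n+4)/(n+2) ≥ 1 + 1/n` once `n ≥ 2`.
  filter_upwards [hs, hs0, (tendsto_add_atTop_nat 1).eventually (hG 3), hCb.bound,
    eventually_ge_atTop 2] with n h1 h2 h3 h4 hn
  have hn2 : (2 : ℝ) ≤ n := by exact_mod_cast hn
  have hn0 : (0 : ℝ) < n := by linarith
  rw [Real.norm_of_nonneg (by positivity : 0 ≤ 1 / (n : ℝ) ^ p), Real.norm_eq_abs,
    mul_one_div] at h4
  simp only [Real.norm_eq_abs]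
  set D := (2 * n + 3) - (n + 2) * G (n + 1) with hD
  have hDn : (n : ℝ) + 4 ≤ D := by
    have h5 := mul_le_mul_of_nonneg_left h3 (by positivity : 0 ≤ (n : ℝ) + 2)
    have h6 : ((n : ℝ) + 2) * (1 - (3 : ℕ) / ((n + 1 : ℕ) : ℝ)) ≤ n - 1 := by
      have : (3 : ℝ) / (n + 1) * (n + 1) = 3 := by field_simp
      have : (0 : ℝ) ≤ 3 / (n + 1) := by positivity
      push_cast
      linarith
    linarith
  have key : D * (s n - G n) = (n + 2) * s n * (s (n + 1) - G (n + 1)) + ratioDefect G n := by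
    simp only [ratioDefect, hD] at h2 ⊢
    linarith
  have h6 : (n + 4) * |s n - G n| ≤ (n + 2) * |s (n + 1) - G (n + 1)| + C / (n : ℝ) ^ p := by
    calc (n + 4) * |s n - G n| ≤ D * |s n - G n| := by gcongr
      _ = |D * (s n - G n)| := by rw [abs_mul, abs_of_pos (by linarith : 0 < D)]
      _ ≤ (n + 2) * s n * |s (n + 1) - G (n + 1)| + |ratioDefect G n| := by
        rw [key]
        refine (abs_add_le _ _).trans ?_
        rw [abs_mul, abs_of_pos (by have := h1.1; positivity : 0 < (n + 2) * s n)]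
      _ ≤ _ := by
        gcongr
        exact mul_le_of_le_one_right (by positivity) h1.2.le
  have h7 : (0 : ℝ) < n + 2 := by positivity
  refine le_of_mul_le_mul_left ?_ h7
  calc (n + 2) * ((1 + 1 / n) * |s n - G n|) = ((n + 2) * (1 + 1 / n)) * |s n - G n| := by ring
    _ ≤ (n + 4) * |s n - G n| := by
      gcongr
      have : 2 / (n : ℝ) ≤ 1 := (div_le_one hn0).2 hn2
      have h8 : ((n : ℝ) + 2) * (1 + 1 / n) = n + 3 + 2 / n := by field_simp; ring
      linarith
    _ ≤ _ := h6
    _ ≤ _ := by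
      rw [mul_add]
      gcongr
      rw [pow_succ, mul_div_assoc', le_div_iff₀ (by positivity)]
      rw [div_mul_eq_mul_div, div_le_iff₀ (by positivity)]
      have : 0 < C * (n : ℝ) ^ p := by positivity
      linarith

/-! ### Passage to integer powers of `1/n`. -/

open Polynomial in
theorem Polynomial.exists_eval_sub_eval_neg (h : ℝ[X]) :
    ∃ Q : ℝ[X], ∀ t, h.eval t - h.eval (-t) = 2 * t * Q.eval (t ^ 2) := by
  induction h using Polynomial.induction_on' with
  | add p q hp hq =>
    obtain ⟨P, hP⟩ := hp
    obtain ⟨Q, hQ⟩ := hq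
    refine ⟨P + Q, fun t => ?_⟩
    simp only [eval_add]
    linear_combination hP t + hQ t
  | monomial n a =>
    rcases n.even_or_odd' with ⟨k, rfl | rfl⟩
    · refine ⟨0, fun t => ?_⟩
      simp [(even_two_mul k).neg_pow]
    · refine ⟨C a * X ^ k, fun t => ?_⟩
      simp [(odd_two_mul_add_one k).neg_pow, ← pow_mul]
      ring

theorem exists_hasAsymptoticSum_of_isBigO {u v : ℕ → ℝ} {Q : Polynomial ℝ} (hQ : Q.eval 0 = 1)
    {m : ℕ} (hm : 1 ≤ m) (hv : (fun n : ℕ => v n - Q.eval (1 / (n : ℝ))) =O[atTop]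
      fun n : ℕ => 1 / (n : ℝ) ^ m)
    (hu : ∀ᶠ n : ℕ in atTop, u n = 1 / ((1 + 1 / (n : ℝ)) * v n)) :
    (∃ c, HasAsymptoticSum u c m) ∧ Tendsto u atTop (𝓝 1) := by
  have hx := tendsto_one_div_natCast
  have hQt : Tendsto (fun n : ℕ => Q.eval (1 / (n : ℝ))) atTop (𝓝 1) := by
    have := (Q.continuous.tendsto 0).comp hx
    rwa [hQ] at this
  have hvt : Tendsto v atTop (𝓝 1) := by
    have h1 := (hv.trans (isBigO_one_div_pow_of_le hm)).trans_tendsto (by simpa using hx)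
    simpa using h1.add hQt
  have hxt : Tendsto (fun n : ℕ => 1 + 1 / (n : ℝ)) atTop (𝓝 1) := by
    simpa using hx.const_add 1
  refine ⟨?_, ?_⟩
  · have hana : AnalyticAt ℝ (fun x : ℝ => 1 / ((1 + x) * Q.eval x)) 0 := by
      have hQa : AnalyticAt ℝ (fun x : ℝ => Q.eval x) 0 := by
        have := (analyticAt_id (𝕜 := ℝ) (z := (0 : ℝ))).aeval_polynomial Q
        simp only [id, Polynomial.coe_aeval_eq_eval] at this
        exact this
      refine analyticAt_const.fun_div ((analyticAt_const.fun_add analyticAt_id).fun_mul hQa) ?_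
      simp [hQ]
    obtain ⟨c, hc⟩ := hana.exists_hasAsymptoticSum m
    refine ⟨c, ?_⟩
    have hbdd : (fun n : ℕ => -1 / ((1 + 1 / (n : ℝ)) * v n * Q.eval (1 / (n : ℝ))))
        =O[atTop] fun _ => (1 : ℝ) := by
      refine Tendsto.isBigO_one ℝ (c := -1 / (1 * 1 * 1)) ?_
      exact tendsto_const_nhds.div ((hxt.mul hvt).mul hQt) (by norm_num)
    have hd := hv.mul hbdd
    simp only [mul_one] at hd
    refine (IsBigO.add hd hc).congr' ?_ EventuallyEq.rfl
    filter_upwards [hu, hxt.eventually_ne one_ne_zero, hvt.eventually_ne one_ne_zero,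
      hQt.eventually_ne one_ne_zero] with n h1 h2 h3 h4
    rw [h1, ← add_sub_assoc]
    congr 1
    generalize 1 + 1 / (n : ℝ) = X at *
    field_simp
    ring
  · have h1 : Tendsto (fun n : ℕ => 1 / ((1 + 1 / (n : ℝ)) * v n)) atTop (𝓝 (1 / (1 * 1))) :=
      tendsto_const_nhds.div (hxt.mul hvt) (by norm_num)
    simp only [mul_one, div_one] at h1
    exact h1.congr' (hu.mono fun n hn => hn.symm)

/-- Ratio of consecutive Maclaurin coefficients. -/
def coeffRatio (y : ℝ → ℝ) (n : ℕ) : ℝ := maclaurinCoeff y (n + 1) / maclaurinCoeff y n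

theorem ratioDefect_coeffRatio {y : ℝ → ℝ} {c : ℝ}
    (hy : ∀ z < 1, HasDerivAt y ((y z - c * (1 - z)) / (1 - z) ^ 2) z) {n : ℕ} (hn : n ≠ 0)
    (h0 : maclaurinCoeff y n ≠ 0) (h1 : maclaurinCoeff y (n + 1) ≠ 0) :
    ratioDefect (coeffRatio y) n = 0 := by
  have h := maclaurinCoeff_recurrence hy n
  rw [if_neg hn] at h
  simp only [ratioDefect, coeffRatio]
  field_simp
  linear_combination h

/-- The normalized sequence `-2 n^{3/2} ρ_n`. -/
def scaledRho (n : ℕ) : ℝ := -(2 * (n : ℝ) ^ (3 / 2 : ℝ)) * rho n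

theorem natCast_rpow_three_halves (n : ℕ) : (n : ℝ) ^ (3 / 2 : ℝ) = n * √(n : ℝ) := by
  rcases n.eq_zero_or_pos with rfl | hn
  · simp
  · have : (0 : ℝ) < n := by exact_mod_cast hn
    rw [Real.sqrt_eq_rpow, show (3 / 2 : ℝ) = 1 + 1 / 2 by norm_num, Real.rpow_add this,
      Real.rpow_one]

theorem maclaurinCoeff_f0_pos {n : ℕ} (hn : 1 ≤ n) : 0 < maclaurinCoeff f0 n := by
  obtain ⟨m, rfl⟩ := Nat.exists_eq_add_of_le' hn
  exact (maclaurinCoeff_f0_pos_le m).1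

theorem maclaurinCoeff_f1_neg' {n : ℕ} (hn : 1 ≤ n) : maclaurinCoeff f1 n < 0 := by
  obtain ⟨m, rfl⟩ := Nat.exists_eq_add_of_le' hn
  exact maclaurinCoeff_f1_neg m

theorem one_le_coeffRatio_f0 {n : ℕ} (hn : 1 ≤ n) : 1 ≤ coeffRatio f0 n := by
  obtain ⟨m, rfl⟩ := Nat.exists_eq_add_of_le' hn
  rw [coeffRatio, one_le_div (maclaurinCoeff_f0_pos_le m).1]
  exact (maclaurinCoeff_f0_pos_le m).2

theorem coeffRatio_f1_mem {n : ℕ} (hn : 1 ≤ n) : 0 < coeffRatio f1 n ∧ coeffRatio f1 n < 1 := by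
  obtain ⟨m, rfl⟩ := Nat.exists_eq_add_of_le' hn
  refine ⟨div_pos_of_neg_of_neg (maclaurinCoeff_f1_neg _) (maclaurinCoeff_f1_neg m), ?_⟩
  rw [coeffRatio, div_lt_one_of_neg (maclaurinCoeff_f1_neg m)]
  exact maclaurinCoeff_f1_lt m

/-- The Casoratian divided by `a_n b_n` turns the product `ρ_n` into a reciprocal of the difference
of ratios. -/
theorem scaledRho_eq {n : ℕ} (hn : 1 ≤ n) : scaledRho n =
    1 / ((1 + 1 / (n : ℝ)) * (√(n : ℝ) / 2 * (coeffRatio f0 n - coeffRatio f1 n))) := by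
  have hn0 : (0 : ℝ) < n := by exact_mod_cast hn
  have h0 := (maclaurinCoeff_f0_pos hn).ne'
  have h1 := (maclaurinCoeff_f1_neg' hn).ne
  have hlt : 0 < coeffRatio f0 n - coeffRatio f1 n :=
    sub_pos.2 ((coeffRatio_f1_mem hn).2.trans_le (one_le_coeffRatio_f0 hn))
  have hs := Real.sqrt_pos.2 hn0
  have hss := Real.mul_self_sqrt hn0.le
  have hW : rho n * (coeffRatio f0 n - coeffRatio f1 n) = -1 / (n * (n + 1)) := by
    obtain ⟨m, rfl⟩ := Nat.exists_eq_add_of_le' hn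
    have := casoratian m
    simp only [rho, coeffRatio]
    field_simp at this ⊢
    push_cast
    linear_combination this
  rw [eq_div_iff (by positivity), scaledRho, natCast_rpow_three_halves]
  have e : -(2 * (n * √(n : ℝ))) * rho n * ((1 + 1 / (n : ℝ)) * (√(n : ℝ) / 2 *
      (coeffRatio f0 n - coeffRatio f1 n))) = -(√(n : ℝ) * √(n : ℝ)) * (n * (1 + 1 / n)) *
        (rho n * (coeffRatio f0 n - coeffRatio f1 n)) := by ring
  rw [e, hW, hss]
  field_simp

open Polynomial in
theorem exists_hasAsymptoticSum_scaledRho {m : ℕ} (hm : 1 ≤ m) :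
    (∃ c, HasAsymptoticSum scaledRho c m) ∧ Tendsto scaledRho atTop (𝓝 1) := by
  -- One order is spent on the factor `√n / 2`, bounded crudely by `n`.
  obtain ⟨h, hh⟩ := exists_ratioDefect_isBigO (m + 1)
  obtain ⟨Q, hQ⟩ := h.exists_eval_sub_eval_neg
  set G : ℝ → ℕ → ℝ := fun ε n =>
    1 + ε / √(n : ℝ) + (ε / √(n : ℝ)) ^ 2 * h.eval (ε / √(n : ℝ)) with hG
  have hGt : Tendsto (G (-1)) atTop (𝓝 1) := by
    have h1 := tendsto_div_sqrt_natCast (-1)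
    have h2 := ((h1.const_add 1).add ((h1.pow 2).mul ((h.continuous.tendsto 0).comp h1)))
    simpa using h2
  have e0 := sub_isBigO_of_one_le_ratio (r := coeffRatio f0) (G := G 1)
    (by filter_upwards [eventually_ge_atTop 1] with n hn using one_le_coeffRatio_f0 hn)
    (by
      filter_upwards [eventually_ge_atTop 1] with n hn
      exact ratioDefect_coeffRatio hasDerivAt_f0 (by omega) (maclaurinCoeff_f0_pos hn).ne'
        (maclaurinCoeff_f0_pos (by omega)).ne')
    (fun q => by
      filter_upwards [eventually_mul_le_add_sq_mul_eval h 1 (by norm_num) q] with n hn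
      simp only [hG]
      linarith)
    (hh 1 (by norm_num))
  have e1 := sub_isBigO_of_ratio_lt_one (s := coeffRatio f1) (G := G (-1))
    (by filter_upwards [eventually_ge_atTop 1] with n hn using coeffRatio_f1_mem hn)
    (by
      filter_upwards [eventually_ge_atTop 1] with n hn
      exact ratioDefect_coeffRatio hasDerivAt_f1 (by omega) (maclaurinCoeff_f1_neg' hn).ne
        (maclaurinCoeff_f1_neg' (by omega)).ne)
    (fun q => by
      filter_upwards [eventually_mul_le_add_sq_mul_eval h (-1) (by norm_num) q] with n hn
      simp only [hG]
      have : (-1 : ℝ) / √(n : ℝ) = -(1 / √(n : ℝ)) := by ring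
      rw [this] at hn ⊢
      linarith)
    hGt (hh (-1) (by norm_num))
  refine exists_hasAsymptoticSum_of_isBigO (Q := 1 + X * Q)
    (v := fun n => √(n : ℝ) / 2 * (coeffRatio f0 n - coeffRatio f1 n)) (by simp) hm ?_
    (by filter_upwards [eventually_ge_atTop 1] with n hn using scaledRho_eq hn)
  have hs : (fun n : ℕ => √(n : ℝ) / 2) =O[atTop] fun n : ℕ => (n : ℝ) := by
    refine IsBigO.of_bound 1 ?_
    filter_upwards [eventually_ge_atTop 1] with n hn
    have hn1 : (1 : ℝ) ≤ n := by exact_mod_cast hn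
    rw [Real.norm_of_nonneg (by positivity), Real.norm_of_nonneg (by positivity), one_mul]
    have hn0' : (0 : ℝ) ≤ n := by positivity
    have : √(n : ℝ) ≤ n := Real.sqrt_le_iff.2 ⟨hn0', by nlinarith⟩
    linarith
  refine (hs.mul (e0.sub e1)).congr' ?_ ?_ <;> filter_upwards [eventually_ge_atTop 1] with n hn <;>
    have hn0 : (0 : ℝ) < n := by exact_mod_cast hn
  · have hsp := Real.sqrt_pos.2 hn0
    have h1 := hQ (1 / √(n : ℝ))
    have h2 : (1 / √(n : ℝ)) ^ 2 = 1 / n := by rw [div_pow, Real.sq_sqrt hn0.le, one_pow]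
    have h3 : (-1 : ℝ) / √(n : ℝ) = -(1 / √(n : ℝ)) := by ring
    have h4 : √(n : ℝ) / 2 * (2 * (1 / √(n : ℝ))) = 1 := by field_simp
    rw [h2] at h1
    simp only [hG, h3, neg_sq, h2, eval_add, eval_mul, eval_one, eval_X]
    linear_combination (-√(n : ℝ) / 2 * (1 / n)) * h1 - (1 + 1 / n * Q.eval (1 / (n : ℝ))) * h4
  · rw [pow_succ]
    field_simp

/-! ### The third-order recurrence for `n ρ_n`. -/

/-- Reducing to indices `m` and `m + 1` puts all four products in the span of `a_m b_m`, `a_{m+1}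
b_{m+1}` and `a_m b_{m+1} + a_{m+1} b_m`, so they are linearly dependent. -/
theorem rho_recurrence {m : ℕ} (hm : 1 ≤ m) :
    (2 * ((m : ℝ) + 3) ^ 3 - 5 * (m + 3) ^ 2 + 3 * (m + 3)) * ((m + 3) * rho (m + 3))
    - (6 * ((m : ℝ) + 3) ^ 3 - 13 * (m + 3) ^ 2 + 7 * (m + 3) - 1) * ((m + 2) * rho (m + 2))
    + (6 * ((m : ℝ) + 3) ^ 3 - 19 * (m + 3) ^ 2 + 17 * (m + 3) - 3) * ((m + 1) * rho (m + 1))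
    - (2 * ((m : ℝ) + 3) ^ 3 - 11 * (m + 3) ^ 2 + 17 * (m + 3) - 6) * (m * rho m) = 0 := by
  have hrec : ∀ {y : ℝ → ℝ} {c : ℝ},
      (∀ z < 1, HasDerivAt y ((y z - c * (1 - z)) / (1 - z) ^ 2) z) →
      maclaurinCoeff y (m + 2) = ((2 * m + 3) * maclaurinCoeff y (m + 1)
        - m * maclaurinCoeff y m) / (m + 2) ∧
      maclaurinCoeff y (m + 3) = ((2 * m + 5) * maclaurinCoeff y (m + 2)
        - (m + 1) * maclaurinCoeff y (m + 1)) / (m + 3) := by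
    intro y c hy
    have h1 := maclaurinCoeff_recurrence hy m
    have h2 := maclaurinCoeff_recurrence hy (m + 1)
    rw [if_neg (by omega)] at h1 h2
    push_cast at h2
    refine ⟨?_, ?_⟩ <;> rw [eq_div_iff (by positivity)]
    · linear_combination h1
    · linear_combination h2
  obtain ⟨a2, a3⟩ := hrec hasDerivAt_f0
  obtain ⟨b2, b3⟩ := hrec hasDerivAt_f1
  simp only [rho, a3, b3, a2, b2]
  field_simp
  ring

theorem scaledRho_sub_div {n i : ℕ} (h : i < n) :
    scaledRho (n - i) / (1 - (i : ℝ) / n) ^ (1 / 2 : ℝ)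
      = -2 * √(n : ℝ) * (((n - i : ℕ) : ℝ) * rho (n - i)) := by
  have hn0 : (0 : ℝ) < n := by exact_mod_cast (by omega : 0 < n)
  have hni : (0 : ℝ) < ((n - i : ℕ) : ℝ) := by exact_mod_cast (by omega : 0 < n - i)
  have h1 : 1 - (i : ℝ) / n = ((n - i : ℕ) : ℝ) / n := by
    rw [Nat.cast_sub h.le]
    field_simp
  rw [scaledRho, natCast_rpow_three_halves, ← Real.sqrt_eq_rpow, h1, Real.sqrt_div hni.le]
  have := Real.sqrt_pos.2 hn0
  have := Real.sqrt_pos.2 hni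
  field_simp

theorem scaledRho_recurrence {n : ℕ} (hn : 4 ≤ n) :
    (2 - 5 / (n : ℝ) + 3 / (n : ℝ) ^ 2) * scaledRho n
      - (6 - 13 / (n : ℝ) + 7 / (n : ℝ) ^ 2 - 1 / (n : ℝ) ^ 3)
        * (scaledRho (n - 1) / (1 - ((1 : ℕ) : ℝ) / n) ^ (1 / 2 : ℝ))
      + (6 - 19 / (n : ℝ) + 17 / (n : ℝ) ^ 2 - 3 / (n : ℝ) ^ 3)
        * (scaledRho (n - 2) / (1 - ((2 : ℕ) : ℝ) / n) ^ (1 / 2 : ℝ))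
      - (2 - 11 / (n : ℝ) + 17 / (n : ℝ) ^ 2 - 6 / (n : ℝ) ^ 3)
        * (scaledRho (n - 3) / (1 - ((3 : ℕ) : ℝ) / n) ^ (1 / 2 : ℝ)) = 0 := by
  have h0 : scaledRho n = -2 * √(n : ℝ) * (n * rho n) := by
    simpa using scaledRho_sub_div (n := n) (i := 0) (by omega)
  rw [scaledRho_sub_div (by omega), scaledRho_sub_div (by omega), scaledRho_sub_div (by omega), h0]
  obtain ⟨m, rfl⟩ := Nat.exists_eq_add_of_le' (show 3 ≤ n by omega)
  have h := rho_recurrence (m := m) (by omega)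
  simp only [Nat.add_sub_cancel, show m + 3 - 1 = m + 2 from rfl, show m + 3 - 2 = m + 1 from rfl]
  have h3 : (m : ℝ) + 3 ≠ 0 := by positivity
  push_cast at h ⊢
  refine Eq.trans ?_ (mul_eq_zero_of_right (-2 * √((m : ℝ) + 3) / (m + 3) ^ 3) h)
  field_simp
  ring

theorem exists_hasAsymptoticSeries_scaledRho : ∃ d, HasAsymptoticSeries scaledRho d := by
  refine exists_hasAsymptoticSeries fun m => ?_
  obtain ⟨c, hc⟩ := (exists_hasAsymptoticSum_scaledRho (Nat.le_add_left 1 m)).1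
  exact ⟨c, hc.mono m.le_succ⟩

end

/-! ### Conclusion. -/

theorem corollary3 :
    (∃! d : ℕ → ℝ, IsRhoExpansion d) ∧
    ∀ d : ℕ → ℝ, IsRhoExpansion d →
      (d 0 = 1 ∧
        ∀ k : ℕ, 1 ≤ k →
          8 * (k : ℝ) * d k = ∑ j ∈ Finset.range k, alpha j k * d j) ∧
      (rescaled d 0 = 1 ∧
        ∀ k : ℕ, 1 ≤ k →
          (k : ℝ) * rescaled d k = ∑ j ∈ Finset.range k, beta j k * rescaled d j) := by
  refine ⟨?_, fun d hd => ?_⟩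
  · obtain ⟨d, hd⟩ := exists_hasAsymptoticSeries_scaledRho
    exact ⟨d, hd, fun d' hd' => HasAsymptoticSeries.unique hd' hd⟩
  · have hd' : HasAsymptoticSeries scaledRho d := hd
    have h0 : d 0 = 1 :=
      tendsto_nhds_unique hd'.tendsto (exists_hasAsymptoticSum_scaledRho le_rfl).2
    have hrec := hd'.recurrence
      (by filter_upwards [eventually_ge_atTop 4] with n hn using scaledRho_recurrence hn)
    refine ⟨⟨h0, hrec⟩, by simp [rescaled, h0], fun k hk => ?_⟩
    have h8 : (k : ℝ) * rescaled d k = 2 ^ (6 * k) / 8 * (8 * k * d k) := by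
      rw [rescaled]; ring
    rw [h8, hrec k hk, Finset.mul_sum]
    refine Finset.sum_congr rfl fun j hj => ?_
    have hj := Finset.mem_range.1 hj
    have h2 : (2 : ℝ) ^ (6 * k) / 8 = 8 ^ (2 * k - 2 * j - 1) * 2 ^ (6 * j) := by
      rw [div_eq_iff (by norm_num), show (8 : ℝ) = 2 ^ 3 by norm_num, ← pow_mul, ← pow_add,
        ← pow_add]
      congr 1
      omega
    rw [h2, beta, rescaled]
    ring
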